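/- Let $\Gamma$ be a finite simplicial graph (no loops or multiple edges) that is atomic, i.e. connected, with no vertex of valence $1$, no cycle of length less than $5$, and no separating closed star of a vertex (for every vertex $v$, the graph obtained by deleting $v$ and all its neighbours is connected or empty). Let $\mathbb{G}(\Gamma)$ be the partially commutative group (right-angled Artin group) of $\Gamma$, generated by the vertex set $V(\Gamma)$ subject to the relations $vw=wv$ for all adjacent vertices $v,w$. Let $\psi:\mathbb{G}(\Gamma)\to\mathbb{G}(\Gamma)$ be an injective endomorphism. Then there exist $g\in\mathbb{G}(\Gamma)$, a graph automorphism $\sigma\in\mathrm{Aut}(\Gamma)$ and nonzero integers $k_v$ $(v\in V(\Gamma))$ such that $$\psi(v)=g^{-1}\,\sigma(v)^{k_v}\,g\qquad\text{for all } v\in V(\Gamma).$$ In other words, up to conjugacy, graph automorphism and taking powers, $\psi$ is the identity endomorphism. -/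

import Mathlib

/-- The partially commutative group (right-angled Artin group) of a simplicial graph `Γ`:
generators are the vertices, and two generators commute when the vertices are adjacent. -/
abbrev PCGroup {V : Type*} (Γ : SimpleGraph V) : Type _ :=
  PresentedGroup {r : FreeGroup V | ∃ v w : V, Γ.Adj v w ∧
    r = FreeGroup.of v * FreeGroup.of w * (FreeGroup.of v)⁻¹ * (FreeGroup.of w)⁻¹}

/-- The canonical generator of the partially commutative group attached to the vertex `v`. -/
def PCGroup.gen {V : Type*} (Γ : SimpleGraph V) (v : V) : PCGroup Γ :=
  PresentedGroup.of v

/-- The vertex set of the closed star of `v`: the vertex itself together with its neighbours. -/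
def SimpleGraph.closedStar {V : Type*} (Γ : SimpleGraph V) (v : V) : Set V :=
  insert v (Γ.neighborSet v)

/-- Atomic graphs: connected graphs with no vertices of valence one, no cycles of length less
than five and no separating closed stars of vertices. (Since there are no triangles, the
components of the complement of a closed star are those of the subgraph induced on the
vertices outside it; an empty complement counts as not separated.) -/
structure SimpleGraph.IsAtomic {V : Type*} (Γ : SimpleGraph V) : Prop where
  connected : Γ.Connected
  no_valence_one : ∀ v : V, (Γ.neighborSet v).encard ≠ 1
  no_short_cycle : ∀ (v : V) (c : Γ.Walk v v), c.IsCycle → 5 ≤ c.length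
  no_separating_star : ∀ v : V, (Γ.induce (Γ.closedStar v)ᶜ).Preconnected

/-!
Call a conjugate of a generator a *vertex*; the vertices, two of them adjacent when they commute and
differ, form the extension graph of `Γ`, on which the group acts by conjugation, and the generators
form a copy of `Γ` in it. The theorem says that an injective endomorphism `ψ` carries this copy onto
one of its translates, up to taking powers.

*Geometry.* The set of hyperplanes of the universal cover of the Salvetti complex is the disjoint
union of the coset spaces `G / ⟨link of v⟩`. Counting signed crossings of hyperplanes is a cocycle
`cross` on the group, and it takes only two values on each hyperplane. The deletion condition
`len_conj_zpow_mul_lt` follows: crossing a hyperplane means being shortened by a power of the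
conjugate of a generator dual to it.

*Centralizers.* If `g` commutes with `t`, then `g` almost preserves the set of hyperplanes crossed
by a long power of `t`. By the pigeonhole principle, two elements `p`, `q` commuting with `t` have
powers which, up to powers of `t`, fix one common hyperplane (`exists_wall_fixed`). Since
`Γ` has no triangles or squares, the centralizer of a nonabelian subgroup of the free group on the
link of `x` is `⟨x⟩` (`mem_par_singleton_of_commute`). Hence an element commuting with two elements
without commuting powers is conjugate to a power of a generator (`exists_conj_zpow_of_commute`).
As every generator has two nonadjacent neighbours, `ψ` maps vertices to powers of vertices and so
induces a self-map `φ` of the extension graph which preserves and reflects adjacency. The same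
centralizer computation shows that nonadjacent vertices have at most one common neighbour.

*Separation.* If a finite set of vertices is not contained in a translate of `Γ`, then a star
separates it, and the centre of that star can be found in a translate which contains as
much of the set as possible (`exists_translate`): otherwise one could move across a hyperplane
towards the set. In an atomic graph neither closed stars nor single vertices separate; so a star
separating a copy of `Γ` has its centre outside the copy and contains two of its nonadjacent
vertices (`IsCopy.exists_of_not_linked`), and no star separates a translate of `Γ`
(`linked_of_translate`).

*Conclusion.* The set of pairs of vertices of `Γ` whose images under `φ^n` have a common neighbour
grows with `n`, so it is constant for `n ≥ N`. Suppose that `φ^N(Γ)` is not contained in a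
translate. Choose a translate containing as much of `φ^N(Γ)` as possible and, in it, the centre `c`
of a separating star. By stability, the centre of any star separating `φ^(2N)(Γ)` is the image under
`φ^N` of a vertex, whose star does not separate the translate; therefore `φ^N` maps `c` together
with the part of `φ^N(Γ)` in the translate into one translate. Translating back, some translate
contains more of `φ^N(Γ)` than the maximum, a contradiction
(`IsVertMap.exists_iterate_inTranslate`). So `φ^N(Γ)` is a whole translate, and since it contains
the image of the centre of any star separating `φ(Γ)`, the set `φ(Γ)` is a translate as well.
-/

namespace PCGroup

variable {V : Type*} {Γ : SimpleGraph V}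

/-! ### Generators and standard parabolic subgroups -/

theorem gen_commute_of_adj {v w : V} (h : Γ.Adj v w) : Commute (gen Γ v) (gen Γ w) := by
  have := PresentedGroup.one_of_mem (rels := {r : FreeGroup V | ∃ v w : V, Γ.Adj v w ∧
    r = FreeGroup.of v * FreeGroup.of w * (FreeGroup.of v)⁻¹ * (FreeGroup.of w)⁻¹})
    ⟨v, w, h, rfl⟩
  simp only [map_mul, map_inv] at this
  rw [mul_inv_eq_one, mul_inv_eq_iff_eq_mul] at this
  exact this

/-- The universal property of the partially commutative group. -/
def lift {H : Type*} [Group H] (f : V → H) (hf : ∀ v w, Γ.Adj v w → Commute (f v) (f w)) :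
    PCGroup Γ →* H :=
  PresentedGroup.toGroup (f := f) (by
    rintro r ⟨v, w, h, rfl⟩
    simp only [map_mul, map_inv, FreeGroup.lift_apply_of]
    rw [mul_inv_eq_one, mul_inv_eq_iff_eq_mul]
    exact hf v w h)

@[simp] theorem lift_gen {H : Type*} [Group H] (f : V → H)
    (hf : ∀ v w, Γ.Adj v w → Commute (f v) (f w)) (v : V) : lift f hf (gen Γ v) = f v :=
  PresentedGroup.toGroup.of _

/-- The standard parabolic subgroup generated by a set of vertices. -/
def par (Γ : SimpleGraph V) (A : Set V) : Subgroup (PCGroup Γ) :=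
  Subgroup.closure (gen Γ '' A)

theorem gen_mem_par {A : Set V} {v : V} (h : v ∈ A) : gen Γ v ∈ par Γ A :=
  Subgroup.subset_closure ⟨v, h, rfl⟩

theorem par_mono {A B : Set V} (h : A ⊆ B) : par Γ A ≤ par Γ B :=
  Subgroup.closure_mono (Set.image_mono h)

theorem par_le_iff {A : Set V} {K : Subgroup (PCGroup Γ)} :
    par Γ A ≤ K ↔ ∀ v ∈ A, gen Γ v ∈ K := by
  simp [par, Subgroup.closure_le, Set.subset_def]

theorem par_univ : par Γ Set.univ = ⊤ := by
  rw [par, Set.image_univ]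
  exact PresentedGroup.closure_range_of _

theorem par_empty : par Γ ∅ = ⊥ := by simp [par]

theorem mem_par_singleton {x : V} {g : PCGroup Γ} :
    g ∈ par Γ {x} ↔ ∃ n : ℤ, gen Γ x ^ n = g := by
  rw [par, Set.image_singleton, Subgroup.mem_closure_singleton]

open Classical in
/-- The retraction onto a standard parabolic subgroup, killing all other generators. -/
noncomputable def retract (Γ : SimpleGraph V) (A : Set V) : PCGroup Γ →* PCGroup Γ :=
  lift (fun v => if v ∈ A then gen Γ v else 1) (by
    intro v w h
    split_ifs
    · exact gen_commute_of_adj h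
    all_goals simp)

theorem retract_gen_of_mem {A : Set V} {v : V} (h : v ∈ A) :
    retract Γ A (gen Γ v) = gen Γ v := by
  simp [retract, h]

theorem retract_gen_of_notMem {A : Set V} {v : V} (h : v ∉ A) :
    retract Γ A (gen Γ v) = 1 := by
  simp [retract, h]

theorem retract_mem (A : Set V) (g : PCGroup Γ) : retract Γ A g ∈ par Γ A := by
  have : par Γ Set.univ ≤ (par Γ A).comap (retract Γ A) := by
    rw [par_le_iff]
    intro v _
    by_cases h : v ∈ A
    · simpa [retract_gen_of_mem h] using gen_mem_par h
    · simp [retract_gen_of_notMem h]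
  rw [par_univ] at this
  exact this trivial

theorem retract_of_mem {A : Set V} {g : PCGroup Γ} (h : g ∈ par Γ A) : retract Γ A g = g := by
  have : par Γ A ≤ (retract Γ A).eqLocus (MonoidHom.id _) := by
    rw [par_le_iff]
    intro v hv
    exact retract_gen_of_mem hv
  exact this h

/-- Standard parabolic subgroups intersect in the standard parabolic subgroup on the common
vertices. -/
theorem mem_par_inter {A B : Set V} {g : PCGroup Γ} (hA : g ∈ par Γ A) (hB : g ∈ par Γ B) :
    g ∈ par Γ (A ∩ B) := by
  have : par Γ B ≤ (par Γ (A ∩ B)).comap (retract Γ A) := by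
    rw [par_le_iff]
    intro v hv
    by_cases h : v ∈ A
    · simpa [retract_gen_of_mem h] using gen_mem_par (Set.mem_inter h hv)
    · simp [retract_gen_of_notMem h]
  have h2 := this hB
  rwa [Subgroup.mem_comap, retract_of_mem hA] at h2

open Classical in
/-- The exponent sum of the generator `x`. -/
noncomputable def expo (Γ : SimpleGraph V) (x : V) : PCGroup Γ →* Multiplicative ℤ :=
  lift (fun v => if v = x then Multiplicative.ofAdd 1 else 1) (fun _ _ _ => Commute.all _ _)

theorem expo_gen_self (x : V) : expo Γ x (gen Γ x) = Multiplicative.ofAdd 1 := by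
  simp [expo]

theorem expo_gen_of_ne {x y : V} (h : y ≠ x) : expo Γ x (gen Γ y) = 1 := by
  simp [expo, h]

theorem expo_eq_one_of_mem_par {A : Set V} {x : V} (hx : x ∉ A) {g : PCGroup Γ}
    (hg : g ∈ par Γ A) : expo Γ x g = 1 := by
  have : par Γ A ≤ (expo Γ x).ker := by
    rw [par_le_iff]
    intro v hv
    exact expo_gen_of_ne (by rintro rfl; exact hx hv)
  exact this hg

theorem expo_conj (x : V) (g a : PCGroup Γ) : expo Γ x (g * a * g⁻¹) = expo Γ x a := by
  simp

theorem expo_gen_zpow_self (x : V) (n : ℤ) :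
    expo Γ x (gen Γ x ^ n) = Multiplicative.ofAdd n := by
  rw [map_zpow, expo_gen_self, ← ofAdd_zsmul]; simp

theorem gen_zpow_eq_one {x : V} {n : ℤ} (h : gen Γ x ^ n = 1) : n = 0 := by
  have := congrArg (expo Γ x) h
  rwa [expo_gen_zpow_self, map_one, ofAdd_eq_one] at this

theorem gen_injective : Function.Injective (gen Γ) := by
  intro x y h
  by_contra hne
  have := congrArg (expo Γ x) h
  rw [expo_gen_self, expo_gen_of_ne (Ne.symm hne)] at this
  exact absurd this (by decide)

/-! ### Words and word length -/

/-- The group element of a letter; `true` stands for the generator, `false` for its inverse. -/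
def letter (Γ : SimpleGraph V) (s : V × Bool) : PCGroup Γ :=
  if s.2 then gen Γ s.1 else (gen Γ s.1)⁻¹

/-- The inverse letter. -/
def flip (s : V × Bool) : V × Bool := (s.1, !s.2)

theorem letter_flip (s : V × Bool) : letter Γ (flip s) = (letter Γ s)⁻¹ := by
  rcases s with ⟨v, _ | _⟩ <;> simp [letter, flip]

theorem letter_mem_par {A : Set V} {s : V × Bool} (h : s.1 ∈ A) : letter Γ s ∈ par Γ A := by
  rcases s with ⟨v, _ | _⟩ <;> simp only [letter] <;> simpa using gen_mem_par h

/-- The group element represented by a word. -/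
def wordProd (Γ : SimpleGraph V) (w : List (V × Bool)) : PCGroup Γ := (w.map (letter Γ)).prod

@[simp] theorem wordProd_nil : wordProd Γ [] = 1 := rfl

@[simp] theorem wordProd_cons (s : V × Bool) (w : List (V × Bool)) :
    wordProd Γ (s :: w) = letter Γ s * wordProd Γ w := by simp [wordProd]

@[simp] theorem wordProd_append (u w : List (V × Bool)) :
    wordProd Γ (u ++ w) = wordProd Γ u * wordProd Γ w := by simp [wordProd]

theorem wordProd_mem_par {A : Set V} {w : List (V × Bool)} (h : ∀ s ∈ w, s.1 ∈ A) :
    wordProd Γ w ∈ par Γ A := by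
  induction w with
  | nil => exact one_mem _
  | cons s w ih =>
    rw [wordProd_cons]
    exact mul_mem (letter_mem_par (h s (by simp))) (ih fun t ht => h t (by simp [ht]))

theorem wordProd_reverse_flip (w : List (V × Bool)) :
    wordProd Γ ((w.map flip).reverse) = (wordProd Γ w)⁻¹ := by
  induction w with
  | nil => simp
  | cons s w ih => simp [ih, letter_flip]

theorem exists_word_of_mem_par {A : Set V} {g : PCGroup Γ} (h : g ∈ par Γ A) :
    ∃ w : List (V × Bool), (∀ s ∈ w, s.1 ∈ A) ∧ wordProd Γ w = g := by
  induction h using Subgroup.closure_induction with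
  | mem x hx =>
    obtain ⟨v, hv, rfl⟩ := hx
    exact ⟨[(v, true)], by simpa using hv, by simp [letter]⟩
  | one => exact ⟨[], by simp, rfl⟩
  | mul x y _ _ hx hy =>
    obtain ⟨u, hu, rfl⟩ := hx
    obtain ⟨w, hw, rfl⟩ := hy
    refine ⟨u ++ w, ?_, by simp⟩
    intro s hs
    rcases List.mem_append.1 hs with h | h
    exacts [hu s h, hw s h]
  | inv x _ hx =>
    obtain ⟨u, hu, rfl⟩ := hx
    refine ⟨(u.map flip).reverse, ?_, wordProd_reverse_flip u⟩
    intro s hs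
    simp only [List.mem_reverse, List.mem_map] at hs
    obtain ⟨t, ht, rfl⟩ := hs
    exact hu t ht

theorem exists_word (g : PCGroup Γ) : ∃ w : List (V × Bool), wordProd Γ w = g := by
  have : g ∈ par Γ Set.univ := by rw [par_univ]; trivial
  obtain ⟨w, -, hw⟩ := exists_word_of_mem_par this
  exact ⟨w, hw⟩

/-- The word length of an element with respect to the standard generators. -/
noncomputable def len (g : PCGroup Γ) : ℕ :=
  sInf {n | ∃ w : List (V × Bool), wordProd Γ w = g ∧ w.length = n}

theorem exists_geodesic (g : PCGroup Γ) :
    ∃ w : List (V × Bool), wordProd Γ w = g ∧ w.length = len g := by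
  obtain ⟨w, hw⟩ := exists_word g
  exact Nat.sInf_mem (s := {n | ∃ w : List (V × Bool), wordProd Γ w = g ∧ w.length = n})
    ⟨w.length, w, hw, rfl⟩

theorem len_wordProd_le (w : List (V × Bool)) : len (wordProd Γ w) ≤ w.length :=
  Nat.sInf_le ⟨w, rfl, rfl⟩

@[simp] theorem len_one : len (1 : PCGroup Γ) = 0 :=
  Nat.le_zero.1 (len_wordProd_le (Γ := Γ) [])

theorem len_inv_le (g : PCGroup Γ) : len g⁻¹ ≤ len g := by
  obtain ⟨w, rfl, hl⟩ := exists_geodesic g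
  rw [← hl, ← wordProd_reverse_flip]
  exact (len_wordProd_le _).trans (by simp)

theorem len_inv (g : PCGroup Γ) : len g⁻¹ = len g :=
  le_antisymm (len_inv_le g) (by simpa using len_inv_le g⁻¹)

theorem len_mul_le (g h : PCGroup Γ) : len (g * h) ≤ len g + len h := by
  obtain ⟨u, rfl, hu⟩ := exists_geodesic g
  obtain ⟨w, rfl, hw⟩ := exists_geodesic h
  rw [← hu, ← hw, ← wordProd_append, ← List.length_append]
  exact len_wordProd_le _

open Classical in
theorem retract_wordProd (A : Set V) (w : List (V × Bool)) :
    retract Γ A (wordProd Γ w) = wordProd Γ (w.filter fun s => decide (s.1 ∈ A)) := by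
  induction w with
  | nil => simp
  | cons s w ih =>
    rcases s with ⟨v, b⟩
    rw [wordProd_cons, map_mul, ih]
    by_cases h : v ∈ A
    · rw [List.filter_cons_of_pos (by simpa using h), wordProd_cons]
      cases b <;> simp [letter, retract_gen_of_mem h]
    · rw [List.filter_cons_of_neg (by simpa using h)]
      cases b <;> simp [letter, retract_gen_of_notMem h]

theorem len_retract_le (A : Set V) (g : PCGroup Γ) : len (retract Γ A g) ≤ len g := by
  classical
  obtain ⟨w, rfl, hw⟩ := exists_geodesic g
  rw [← hw, retract_wordProd]
  exact (len_wordProd_le _).trans (List.length_filter_le _ _)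

/-- The retraction deletes letters from a word. If this does not shorten the element, then no letter
was deleted. -/
theorem mem_of_len_le_len_retract {A : Set V} {w : List (V × Bool)}
    (h : w.length ≤ len (retract Γ A (wordProd Γ w))) : ∀ s ∈ w, s.1 ∈ A := by
  classical
  have h1 : w.length ≤ (w.filter fun s => decide (s.1 ∈ A)).length := by
    refine h.trans ?_
    rw [retract_wordProd]
    exact len_wordProd_le _
  have h2 : (w.filter fun s => decide (s.1 ∈ A)) = w :=
    List.filter_sublist.eq_of_length_le h1
  intro s hs
  rw [← h2] at hs
  simpa using (List.mem_filter.1 hs).2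

theorem mem_par_of_len_le_len_retract {A : Set V} {g : PCGroup Γ}
    (h : len g ≤ len (retract Γ A g)) : g ∈ par Γ A := by
  obtain ⟨w, rfl, hw⟩ := exists_geodesic g
  exact wordProd_mem_par (mem_of_len_le_len_retract (by rwa [hw]))

/-- If a geodesic product lies in a parabolic subgroup, then so does its first factor. -/
theorem mem_par_of_mul_mem {A : Set V} {g h : PCGroup Γ} (hgh : g * h ∈ par Γ A)
    (hl : len (g * h) = len g + len h) : g ∈ par Γ A := by
  apply mem_par_of_len_le_len_retract
  have h1 := len_mul_le (retract Γ A g) (retract Γ A h)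
  rw [← map_mul, retract_of_mem hgh] at h1
  have := len_retract_le A h
  omega

/-- An induction principle stripping letters off the left of an element, along a geodesic. -/
theorem geodesic_induction {A : Set V} {p : PCGroup Γ → Prop} (one : p 1)
    (mul : ∀ s : V × Bool, s.1 ∈ A → ∀ g ∈ par Γ A, len (letter Γ s * g) = len g + 1 → p g →
      p (letter Γ s * g)) {g : PCGroup Γ} (hg : g ∈ par Γ A) : p g := by
  induction hn : len g using Nat.strong_induction_on generalizing g with
  | _ n ih =>
    obtain ⟨w, rfl, hw⟩ := exists_geodesic g
    have hA := mem_of_len_le_len_retract (A := A) (w := w) (by rw [retract_of_mem hg, hw])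
    cases w with
    | nil => exact one
    | cons s w =>
      have h1 := len_wordProd_le (Γ := Γ) w
      have h2 : len (letter Γ s * wordProd Γ w) ≤ 1 + len (wordProd Γ w) := by
        refine (len_mul_le _ _).trans (Nat.add_le_add_right ?_ _)
        simpa using len_wordProd_le (Γ := Γ) [s]
      rw [wordProd_cons] at hw hn ⊢
      simp only [List.length_cons] at hw
      have hm : wordProd Γ w ∈ par Γ A := wordProd_mem_par fun t ht => hA t (by simp [ht])
      exact mul s (hA s (by simp)) _ hm (by omega) (ih _ (by omega) hm rfl)

/-! ### Hyperplanes and the crossing cocycle -/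

/-- The hyperplanes: a hyperplane of type `v` is a left coset of the subgroup generated by the
neighbours of `v`. -/
abbrev Wall (Γ : SimpleGraph V) : Type _ := Σ v : V, PCGroup Γ ⧸ par Γ (Γ.neighborSet v)

/-- The hyperplane dual to the edge from `1` to the generator `v` of the Cayley graph. -/
def baseWall (Γ : SimpleGraph V) (v : V) : Wall Γ := ⟨v, ((1 : PCGroup Γ) : PCGroup Γ ⧸ _)⟩

theorem smul_baseWall_eq_iff {g h : PCGroup Γ} {x y : V} :
    g • baseWall Γ x = h • baseWall Γ y ↔ x = y ∧ g⁻¹ * h ∈ par Γ (Γ.neighborSet x) := by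
  constructor
  · intro e
    have hxy : x = y := congrArg Sigma.fst e
    subst hxy
    refine ⟨rfl, ?_⟩
    have := eq_of_heq (Sigma.mk.inj e).2
    change ((g * 1 : PCGroup Γ) : PCGroup Γ ⧸ par Γ (Γ.neighborSet x)) =
      ((h * 1 : PCGroup Γ) : PCGroup Γ ⧸ par Γ (Γ.neighborSet x)) at this
    rw [QuotientGroup.eq] at this
    simpa using this
  · rintro ⟨rfl, h1⟩
    have : ((g * 1 : PCGroup Γ) : PCGroup Γ ⧸ par Γ (Γ.neighborSet x)) =
        ((h * 1 : PCGroup Γ) : PCGroup Γ ⧸ par Γ (Γ.neighborSet x)) := by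
      rw [QuotientGroup.eq]; simpa using h1
    exact congrArg (Sigma.mk x) this

theorem exists_smul_baseWall (H : Wall Γ) : ∃ (g : PCGroup Γ) (x : V), H = g • baseWall Γ x := by
  obtain ⟨x, q⟩ := H
  induction q using QuotientGroup.induction_on with
  | H g => exact ⟨g, x, by
      change _ = (⟨x, ((g * 1 : PCGroup Γ) : PCGroup Γ ⧸ _)⟩ : Wall Γ)
      rw [mul_one]⟩

theorem par_neighborSet_le_centralizer (x : V) :
    par Γ (Γ.neighborSet x) ≤ Subgroup.centralizer {gen Γ x} := by
  rw [par_le_iff]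
  intro v hv
  rw [Subgroup.mem_centralizer_singleton_iff]
  exact (gen_commute_of_adj hv).symm

theorem commute_of_mem_par_neighborSet {x : V} {g : PCGroup Γ}
    (h : g ∈ par Γ (Γ.neighborSet x)) : Commute (gen Γ x) g :=
  (Subgroup.mem_centralizer_singleton_iff.1 (par_neighborSet_le_centralizer x h)).symm

/-- The conjugate of a generator dual to a hyperplane is well defined. -/
theorem conj_eq_of_smul_baseWall_eq {g h : PCGroup Γ} {x y : V}
    (e : g • baseWall Γ x = h • baseWall Γ y) :
    g * gen Γ x * g⁻¹ = h * gen Γ y * h⁻¹ := by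
  obtain ⟨rfl, hm⟩ := smul_baseWall_eq_iff.1 e
  have := (commute_of_mem_par_neighborSet hm).eq
  calc g * gen Γ x * g⁻¹ = g * (gen Γ x * (g⁻¹ * h)) * h⁻¹ := by group
    _ = _ := by rw [this]; group

open Classical in
/-- The affine action on functions on hyperplanes from which the crossing cocycle is read off. -/
noncomputable def crossPerm (Γ : SimpleGraph V) : PCGroup Γ →* Equiv.Perm (Wall Γ → ℤ) :=
  lift (fun v =>
    { toFun := fun m H => (if H = baseWall Γ v then 1 else 0) + m ((gen Γ v)⁻¹ • H)
      invFun := fun m H => m (gen Γ v • H) - (if gen Γ v • H = baseWall Γ v then 1 else 0)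
      left_inv := fun m => by ext H; simp
      right_inv := fun m => by ext H; simp }) (by
    intro v w h
    have key : ∀ {a b : V}, Γ.Adj a b → ∀ H : Wall Γ,
        ((gen Γ a)⁻¹ • H = baseWall Γ b ↔ H = baseWall Γ b) := by
      intro a b hab H
      rw [inv_smul_eq_iff]
      have : gen Γ a • baseWall Γ b = baseWall Γ b := by
        conv_rhs => rw [← one_smul (PCGroup Γ) (baseWall Γ b)]
        rw [smul_baseWall_eq_iff]
        exact ⟨rfl, by
          rw [mul_one, inv_mem_iff]
          exact gen_mem_par hab.symm⟩
      rw [this]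
    refine Equiv.ext fun m => ?_
    ext H
    simp only [Equiv.Perm.coe_mul, Function.comp_apply, Equiv.coe_fn_mk, key h, key h.symm,
      smul_smul, ← mul_inv_rev, (gen_commute_of_adj h).eq]
    ring)

open Classical in
theorem crossPerm_gen (v : V) (m : Wall Γ → ℤ) (H : Wall Γ) :
    crossPerm Γ (gen Γ v) m H = (if H = baseWall Γ v then 1 else 0) + m ((gen Γ v)⁻¹ • H) := by
  have h : crossPerm Γ (gen Γ v) = _ := lift_gen _ _ v
  rw [h]
  rfl

open Classical in
theorem crossPerm_gen_inv (v : V) (m : Wall Γ → ℤ) (H : Wall Γ) :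
    crossPerm Γ (gen Γ v)⁻¹ m H =
      m (gen Γ v • H) - (if gen Γ v • H = baseWall Γ v then 1 else 0) := by
  have h := crossPerm_gen v (crossPerm Γ (gen Γ v)⁻¹ m) (gen Γ v • H)
  rw [← Equiv.Perm.mul_apply, ← map_mul, mul_inv_cancel, map_one, inv_smul_smul] at h
  rw [Equiv.Perm.one_apply] at h
  linarith

/-- The crossing cocycle: `cross g H` is the signed number of times that a path from `1` to `g` in
the Cayley graph crosses the hyperplane `H`. -/
noncomputable def cross (g : PCGroup Γ) (H : Wall Γ) : ℤ := crossPerm Γ g 0 H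

theorem crossPerm_apply (g : PCGroup Γ) (m : Wall Γ → ℤ) (H : Wall Γ) :
    crossPerm Γ g m H = cross g H + m (g⁻¹ • H) := by
  obtain ⟨w, rfl⟩ := exists_word g
  induction w generalizing m H with
  | nil => simp [cross]
  | cons s w ih =>
    rcases s with ⟨v, _ | _⟩
    · simp only [cross, wordProd_cons, map_mul, Equiv.Perm.coe_mul, Function.comp_apply, letter,
        Bool.false_eq_true, if_false, crossPerm_gen_inv]
      rw [ih, ih]
      simp [smul_smul]
      ring
    · simp only [cross, wordProd_cons, map_mul, Equiv.Perm.coe_mul, Function.comp_apply, letter,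
        if_true, crossPerm_gen]
      rw [ih, ih]
      simp [smul_smul]
      ring

theorem cross_mul (g h : PCGroup Γ) (H : Wall Γ) :
    cross (g * h) H = cross g H + cross h (g⁻¹ • H) := by
  rw [cross, map_mul, Equiv.Perm.mul_apply, crossPerm_apply]
  rfl

@[simp] theorem cross_one (H : Wall Γ) : cross 1 H = 0 := by simp [cross]

open Classical in
theorem cross_gen (v : V) (H : Wall Γ) :
    cross (gen Γ v) H = if H = baseWall Γ v then 1 else 0 := by
  simp [cross, crossPerm_gen]

theorem cross_inv (g : PCGroup Γ) (H : Wall Γ) : cross g⁻¹ H = - cross g (g • H) := by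
  have := cross_mul g⁻¹ g H
  simp at this
  linarith

/-- The hyperplane dual to the edge from `1` to a letter. -/
def wall (Γ : SimpleGraph V) (s : V × Bool) : Wall Γ :=
  if s.2 then baseWall Γ s.1 else (gen Γ s.1)⁻¹ • baseWall Γ s.1

/-- The sign of a letter. -/
def sgn (s : V × Bool) : ℤ := if s.2 then 1 else -1

theorem letter_eq (s : V × Bool) : letter Γ s = gen Γ s.1 ^ sgn s := by
  rcases s with ⟨v, _ | _⟩ <;> simp [letter, sgn]

theorem sgn_ne_zero (s : V × Bool) : sgn s ≠ 0 := by
  rcases s with ⟨v, _ | _⟩ <;> simp [sgn]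

theorem wall_flip (s : V × Bool) : wall Γ (flip s) = (letter Γ s)⁻¹ • wall Γ s := by
  rcases s with ⟨v, _ | _⟩ <;> simp [wall, flip, letter]

open Classical in
theorem cross_letter (s : V × Bool) (H : Wall Γ) :
    cross (letter Γ s) H = if H = wall Γ s then sgn s else 0 := by
  rcases s with ⟨v, _ | _⟩
  · simp only [letter, wall, sgn, Bool.false_eq_true, if_false, cross_inv, cross_gen,
      eq_inv_smul_iff]
    split_ifs <;> simp
  · simp only [letter, wall, sgn, if_true, cross_gen]

theorem exists_wall_eq (s : V × Bool) : ∃ n : ℤ, wall Γ s = gen Γ s.1 ^ n • baseWall Γ s.1 := by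
  rcases s with ⟨v, _ | _⟩
  · exact ⟨-1, by simp [wall]⟩
  · exact ⟨0, by simp [wall]⟩

/-- If the wall of a letter is a given translate of a base wall, then the dual conjugate is the
generator of that letter. -/
theorem conj_eq_of_wall_eq {s : V × Bool} {h : PCGroup Γ} {y : V}
    (e : h • baseWall Γ y = wall Γ s) : h * gen Γ y * h⁻¹ = gen Γ s.1 := by
  obtain ⟨n, hn⟩ := exists_wall_eq (Γ := Γ) s
  rw [conj_eq_of_smul_baseWall_eq (e.trans hn)]
  rw [(Commute.refl (gen Γ s.1)).zpow_left n |>.eq, mul_inv_cancel_right]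

/-- A path in a parabolic subgroup only crosses hyperplanes dual to its own edges. -/
theorem exists_of_cross_ne_zero {A : Set V} {g : PCGroup Γ} (hg : g ∈ par Γ A) {H : Wall Γ}
    (h : cross g H ≠ 0) : ∃ u ∈ par Γ A, ∃ y ∈ A, H = u • baseWall Γ y := by
  obtain ⟨w, hw, rfl⟩ := exists_word_of_mem_par hg
  clear hg
  induction w generalizing H with
  | nil => simp at h
  | cons s w ih =>
    have hs := hw s (by simp)
    rw [wordProd_cons, cross_mul] at h
    by_cases h1 : cross (wordProd Γ w) ((letter Γ s)⁻¹ • H) = 0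
    · rw [h1, add_zero, cross_letter] at h
      have hH : H = wall Γ s := by by_contra hne; simp [hne] at h
      obtain ⟨n, hn⟩ := exists_wall_eq (Γ := Γ) s
      exact ⟨_, zpow_mem (gen_mem_par hs) n, s.1, hs, hH.trans hn⟩
    · obtain ⟨u, hu, y, hy, e⟩ := ih (fun t ht => hw t (by simp [ht])) h1
      rw [inv_smul_eq_iff, smul_smul] at e
      exact ⟨_, mul_mem (letter_mem_par hs) hu, y, hy, e⟩

theorem cross_of_mem_par_neighborSet {x : V} {k : PCGroup Γ} (hk : k ∈ par Γ (Γ.neighborSet x))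
    (g : PCGroup Γ) : cross k (g • baseWall Γ x) = 0 := by
  by_contra h
  obtain ⟨u, -, y, hy, e⟩ := exists_of_cross_ne_zero hk h
  obtain ⟨rfl, -⟩ := smul_baseWall_eq_iff.1 e
  exact Γ.loopless.irrefl x hy

/-- The two sides of the wall `baseWall x` are the level sets of `cross · (baseWall x)`. -/
theorem cross_baseWall (g : PCGroup Γ) (x : V) :
    cross g (baseWall Γ x) = 0 ∨ cross g (baseWall Γ x) = 1 := by
  classical
  obtain ⟨w, hw⟩ := exists_word g⁻¹
  induction w generalizing g with
  | nil =>
    rw [wordProd_nil, eq_comm, inv_eq_one] at hw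
    simp [hw]
  | cons s w ih =>
    have hg : g = (wordProd Γ w)⁻¹ * letter Γ (flip s) := by
      rw [letter_flip, ← mul_inv_rev, ← wordProd_cons, hw, inv_inv]
    have h1 := ih (wordProd Γ w)⁻¹ (by simp)
    set k := (wordProd Γ w)⁻¹
    set t := flip s
    rw [hg, cross_mul, cross_letter]
    by_cases hH : k⁻¹ • baseWall Γ x = wall Γ t
    · rw [if_pos hH]
      rcases t with ⟨z, _ | _⟩
      · simp only [wall, Bool.false_eq_true, if_false] at hH
        obtain ⟨rfl, hm⟩ := smul_baseWall_eq_iff.1 hH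
        rw [inv_inv] at hm
        have hk : k = (k * (gen Γ x)⁻¹) * gen Γ x := by group
        have : cross k (baseWall Γ x) = 1 := by
          rw [hk, cross_mul, cross_gen]
          have e1 := cross_of_mem_par_neighborSet hm 1
          rw [one_smul] at e1
          rw [e1, if_pos, zero_add]
          conv_rhs => rw [← one_smul (PCGroup Γ) (baseWall Γ x)]
          rw [smul_baseWall_eq_iff]
          exact ⟨rfl, by simpa using hm⟩
        simp [this, sgn]
      · simp only [wall, if_true] at hH
        rw [← one_smul (PCGroup Γ) (baseWall Γ z)] at hH
        obtain ⟨rfl, hm⟩ := smul_baseWall_eq_iff.1 hH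
        have e1 := cross_of_mem_par_neighborSet (by simpa using hm) (1 : PCGroup Γ) (k := k)
        rw [one_smul] at e1
        simp [e1, sgn]
    · rw [if_neg hH, add_zero]; exact h1

theorem cross_wall (g : PCGroup Γ) (s : V × Bool) :
    cross g (wall Γ s) = 0 ∨ cross g (wall Γ s) = sgn s := by
  rcases s with ⟨x, _ | _⟩
  · have h := cross_baseWall (gen Γ x * g) x
    rw [cross_mul, cross_gen, if_pos rfl] at h
    simp only [wall, sgn, Bool.false_eq_true, if_false]
    omega
  · simpa [wall, sgn] using cross_baseWall g x

/-- The deletion condition: an element whose path crosses a hyperplane is shortened by a power of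
the conjugate of a generator dual to that hyperplane. -/
theorem len_conj_zpow_mul_lt {g h : PCGroup Γ} {y : V} (hc : cross g (h • baseWall Γ y) ≠ 0) :
    len ((h * gen Γ y * h⁻¹) ^ (-cross g (h • baseWall Γ y)) * g) < len g := by
  classical
  suffices key : ∀ w : List (V × Bool), ∀ h : PCGroup Γ,
      cross (wordProd Γ w) (h • baseWall Γ y) ≠ 0 → ∃ w' : List (V × Bool),
      w'.length < w.length ∧ wordProd Γ w' =
        (h * gen Γ y * h⁻¹) ^ (-cross (wordProd Γ w) (h • baseWall Γ y)) * wordProd Γ w by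
    obtain ⟨w, rfl, hw⟩ := exists_geodesic g
    obtain ⟨w', h1, h2⟩ := key w h hc
    rw [← h2, ← hw]
    exact (len_wordProd_le _).trans_lt h1
  intro w
  induction w with
  | nil => intro h hc; simp at hc
  | cons s w ih =>
    intro h hc
    rw [wordProd_cons, cross_mul, cross_letter, smul_smul] at hc ⊢
    have key := cross_wall (letter Γ s * wordProd Γ w) s
    rw [cross_mul, cross_letter, if_pos rfl] at key
    by_cases hH : h • baseWall Γ y = wall Γ s
    · have e : ((letter Γ s)⁻¹ * h) • baseWall Γ y = (letter Γ s)⁻¹ • wall Γ s := by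
        rw [mul_smul, hH]
      rw [if_pos hH, e] at hc ⊢
      have h0 : cross (wordProd Γ w) ((letter Γ s)⁻¹ • wall Γ s) = 0 := by
        rcases key with k | k
        · exact absurd k hc
        · linarith
      refine ⟨w, by simp, ?_⟩
      rw [h0, add_zero, conj_eq_of_wall_eq hH, letter_eq, ← mul_assoc, ← zpow_add]
      simp
    · rw [if_neg hH, zero_add] at hc ⊢
      obtain ⟨w', h1, h2⟩ := ih _ hc
      refine ⟨s :: w', by simpa using h1, ?_⟩
      rw [wordProd_cons, h2]
      set n := -cross (wordProd Γ w) (((letter Γ s)⁻¹ * h) • baseWall Γ y)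
      have : (letter Γ s)⁻¹ * h * gen Γ y * ((letter Γ s)⁻¹ * h)⁻¹ =
          (letter Γ s)⁻¹ * (h * gen Γ y * h⁻¹) * ((letter Γ s)⁻¹)⁻¹ := by group
      rw [this, conj_zpow]
      group

theorem len_lt_of_cross_ne_zero {g : PCGroup Γ} {s : V × Bool} (h : cross g (wall Γ s) ≠ 0) :
    len ((letter Γ s)⁻¹ * g) < len g := by
  obtain ⟨n, hn⟩ := exists_wall_eq (Γ := Γ) s
  have h1 := (cross_wall g s).resolve_left h
  rw [hn] at h h1
  have := len_conj_zpow_mul_lt h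
  rwa [conj_eq_of_wall_eq hn.symm, h1, zpow_neg, ← letter_eq] at this

theorem len_lt_of_cross_eq_zero {g : PCGroup Γ} {s : V × Bool} (h : cross g (wall Γ s) = 0) :
    len g < len ((letter Γ s)⁻¹ * g) := by
  have := len_lt_of_cross_ne_zero (g := (letter Γ s)⁻¹ * g) (s := flip s) (by
    classical
    rw [cross_mul, ← letter_flip, cross_letter, if_pos rfl, letter_flip, inv_inv, wall_flip,
      smul_inv_smul, h, add_zero]
    exact sgn_ne_zero _)
  rwa [letter_flip, inv_inv, mul_inv_cancel_left] at this

theorem cross_finite (g : PCGroup Γ) : (Function.support (cross g)).Finite := by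
  classical
  obtain ⟨w, rfl⟩ := exists_word g
  induction w with
  | nil =>
    convert Set.finite_empty
    ext H; simp
  | cons s w ih =>
    refine ((Set.finite_singleton (wall Γ s)).union (ih.image (letter Γ s • ·))).subset ?_
    intro H hH
    rw [Function.mem_support, wordProd_cons, cross_mul, cross_letter] at hH
    by_cases h : H = wall Γ s
    · exact Or.inl h
    · rw [if_neg h, zero_add] at hH
      exact Or.inr ⟨_, hH, by simp⟩

/-- The hyperplanes separating `1` from `g`. -/
noncomputable def crossSupport (g : PCGroup Γ) : Finset (Wall Γ) := (cross_finite g).toFinset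

@[simp] theorem mem_crossSupport {g : PCGroup Γ} {H : Wall Γ} :
    H ∈ crossSupport g ↔ cross g H ≠ 0 := by simp [crossSupport]

/-- A geodesic crosses each hyperplane at most once, so its length is at most the number of
hyperplanes separating its ends. -/
theorem len_le_card_crossSupport (g : PCGroup Γ) : len g ≤ (crossSupport g).card := by
  classical
  have : g ∈ par Γ Set.univ := by rw [par_univ]; trivial
  refine geodesic_induction (p := fun g => len g ≤ (crossSupport g).card) ?_ ?_ this
  · simp
  · intro s _ g _ hl ih
    have h0 : cross g (wall Γ (flip s)) = 0 := by
      by_contra h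
      have := len_lt_of_cross_ne_zero h
      rw [letter_flip, inv_inv] at this
      omega
    rw [wall_flip] at h0
    have h1 : insert (wall Γ s) ((crossSupport g).image (letter Γ s • ·)) ⊆
        crossSupport (letter Γ s * g) := by
      intro H hH
      rw [mem_crossSupport, cross_mul, cross_letter]
      rcases Finset.mem_insert.1 hH with rfl | hH
      · rw [if_pos rfl, h0, add_zero]; exact sgn_ne_zero _
      · obtain ⟨H', hH', rfl⟩ := Finset.mem_image.1 hH
        rw [mem_crossSupport] at hH'
        rw [if_neg, zero_add, inv_smul_smul]
        · exact hH'
        · intro e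
          rw [← e, inv_smul_smul] at h0
          exact hH' h0
    have h2 := Finset.card_le_card h1
    rw [Finset.card_insert_of_notMem, Finset.card_image_of_injective _
      (MulAction.injective _)] at h2
    · omega
    · intro hm
      obtain ⟨H', hH', e⟩ := Finset.mem_image.1 hm
      rw [← e, inv_smul_smul] at h0
      exact mem_crossSupport.1 hH' h0

theorem finite_len_le [Finite V] (n : ℕ) : {g : PCGroup Γ | len g ≤ n}.Finite := by
  refine ((List.finite_length_le (V × Bool) n).image (wordProd Γ)).subset ?_
  intro g hg
  obtain ⟨w, hw, hl⟩ := exists_geodesic g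
  exact ⟨w, by simpa [hl] using hg, hw⟩

/-! ### Walls and commuting elements -/

/-- An element commuting with `t` almost preserves the set of hyperplanes crossed by a long power
of `t`; hence finitely many such elements carry crossed hyperplanes to a common hyperplane. -/
theorem exists_common_wall [Finite V] {t : PCGroup Γ} (ht : ¬ IsOfFinOrder t)
    (F : Finset (PCGroup Γ)) (hF : ∀ g ∈ F, Commute t g) :
    ∃ (n : ℕ) (H : Wall Γ), cross (t ^ n) H ≠ 0 ∧ ∀ g ∈ F, cross (t ^ n) (g⁻¹ • H) ≠ 0 := by
  classical
  obtain ⟨n, hn⟩ : ∃ n : ℕ, ∑ g ∈ F, 2 * (crossSupport g).card < len (t ^ n) := by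
    by_contra hcon
    push Not at hcon
    exact Set.infinite_of_injective_forall_mem (injective_pow_iff_not_isOfFinOrder.2 ht) hcon
      (finite_len_le _)
  have hcard : ¬ crossSupport (t ^ n) ⊆
      F.biUnion fun g => crossSupport g ∪ (crossSupport g).image (t ^ n • ·) := by
    intro hsub
    have h1 := Finset.card_le_card hsub
    have h2 : (F.biUnion fun g => crossSupport g ∪ (crossSupport g).image (t ^ n • ·)).card ≤
        ∑ g ∈ F, 2 * (crossSupport g).card := by
      refine Finset.card_biUnion_le.trans (Finset.sum_le_sum fun g _ => ?_)
      refine (Finset.card_union_le _ _).trans ?_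
      have := Finset.card_image_le (s := crossSupport g) (f := (t ^ n • ·))
      omega
    have h3 := len_le_card_crossSupport (t ^ n)
    omega
  obtain ⟨H, hH, hH2⟩ := Finset.not_subset.1 hcard
  rw [mem_crossSupport] at hH
  refine ⟨n, H, hH, fun g hg => ?_⟩
  simp only [Finset.mem_biUnion, not_exists, not_and, Finset.mem_union, not_or] at hH2
  obtain ⟨h1, h2⟩ := hH2 g hg
  have h1' : cross g H = 0 := by simpa using h1
  have h2' : cross g ((t ^ n)⁻¹ • H) = 0 := by
    by_contra hne
    exact h2 (Finset.mem_image.2 ⟨_, mem_crossSupport.2 hne, by simp⟩)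
  have e1 := cross_mul (t ^ n) g H
  have e2 := cross_mul g (t ^ n) H
  rw [((hF g hg).pow_left n).eq, e2, h1', h2', zero_add, add_zero] at e1
  rwa [e1]

/-- The hyperplanes crossed by powers of `t` lie in finitely many `t`-orbits. -/
theorem exists_cross_ne_zero_of_pow {t : PCGroup Γ} {n : ℕ} {H : Wall Γ}
    (h : cross (t ^ n) H ≠ 0) : ∃ b : ℤ, cross t (t ^ b • H) ≠ 0 := by
  induction n generalizing H with
  | zero => simp at h
  | succ n ih =>
    rw [pow_succ', cross_mul] at h
    by_cases h1 : cross t H = 0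
    · rw [h1, zero_add] at h
      obtain ⟨b, hb⟩ := ih h
      refine ⟨b - 1, ?_⟩
      rwa [smul_smul, ← zpow_sub_one] at hb
    · exact ⟨0, by simpa using h1⟩

/-- The pigeonhole principle: if too many translates of `H` by powers of `p` are crossed by `t ^ n`,
then two of them lie in the `t`-orbit of the same hyperplane crossed by `t`. -/
theorem exists_smul_eq_of_forall_cross_ne_zero {t p : PCGroup Γ} (hp : Commute t p) {n : ℕ}
    {H : Wall Γ}
    (h : ∀ i ≤ (crossSupport t).card, cross (t ^ n) ((p ^ i)⁻¹ • H) ≠ 0) :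
    ∃ (a : ℕ) (b : ℤ), 0 < a ∧ (p ^ a * t ^ b) • H = H := by
  have h1 : ∀ i : ℕ, ∃ b : ℤ, i ≤ (crossSupport t).card →
      cross t (t ^ b • (p ^ i)⁻¹ • H) ≠ 0 := by
    intro i
    by_cases hi : i ≤ (crossSupport t).card
    · obtain ⟨b, hb⟩ := exists_cross_ne_zero_of_pow (h i hi)
      exact ⟨b, fun _ => hb⟩
    · exact ⟨0, fun h => absurd h hi⟩
  choose b hb using h1
  have hpc : ∀ (i j : ℕ), i < j → t ^ b i • (p ^ i)⁻¹ • H = t ^ b j • (p ^ j)⁻¹ • H →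
      ∃ (a : ℕ) (b : ℤ), 0 < a ∧ (p ^ a * t ^ b) • H = H := by
    intro i j hij e
    refine ⟨j - i, b i - b j, by omega, ?_⟩
    obtain ⟨d, rfl⟩ := Nat.exists_eq_add_of_lt hij
    have e2 : p ^ (i + d + 1 - i) * t ^ (b i - b (i + d + 1)) =
        (t ^ b (i + d + 1) * (p ^ (i + d + 1))⁻¹)⁻¹ * (t ^ b i * (p ^ i)⁻¹) := by
      have c1 : Commute (p ^ (i + d + 1)) (t ^ b (i + d + 1)) :=
        (hp.symm.pow_left _).zpow_right _
      have c2 : Commute (p ^ i) (t ^ (b i - b (i + d + 1))) := (hp.symm.pow_left _).zpow_right _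
      rw [show i + d + 1 - i = d + 1 by omega, mul_inv_rev, inv_inv, mul_assoc,
        ← mul_assoc (t ^ b (i + d + 1))⁻¹, ← zpow_neg, ← zpow_add,
        show -b (i + d + 1) + b i = b i - b (i + d + 1) by ring, ← mul_assoc,
        show p ^ (i + d + 1) = p ^ (d + 1) * p ^ i by rw [← pow_add]; congr 1; omega,
        mul_assoc (p ^ (d + 1)), c2.eq, ← mul_assoc, mul_inv_cancel_right]
    rw [e2, mul_smul, inv_smul_eq_iff, mul_smul, mul_smul, e]
  obtain ⟨i, hi, j, hj, hne, he⟩ := Finset.exists_ne_map_eq_of_card_lt_of_maps_to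
    (s := Finset.range ((crossSupport t).card + 1)) (t := crossSupport t) (by simp)
    (f := fun i => t ^ b i • (p ^ i)⁻¹ • H) (by
      intro i hi
      have : i ≤ (crossSupport t).card := by
        have := Finset.mem_range.1 (Finset.mem_coe.1 hi); omega
      exact Finset.mem_coe.2 (mem_crossSupport.2 (hb i this)))
  rcases lt_or_gt_of_ne hne with h | h
  · exact hpc i j h he
  · exact hpc j i h he.symm

/-- Two elements commuting with an element `t` of infinite order both have a power which, up to a
power of `t`, fixes a hyperplane crossed by a power of `t`. -/
theorem exists_wall_fixed [Finite V] {t p q : PCGroup Γ} (ht : ¬ IsOfFinOrder t)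
    (hp : Commute t p) (hq : Commute t q) :
    ∃ (n : ℕ) (H : Wall Γ), cross (t ^ n) H ≠ 0 ∧
      (∃ (a : ℕ) (b : ℤ), 0 < a ∧ (p ^ a * t ^ b) • H = H) ∧
      ∃ (a : ℕ) (b : ℤ), 0 < a ∧ (q ^ a * t ^ b) • H = H := by
  classical
  set R := Finset.range ((crossSupport t).card + 1)
  obtain ⟨n, H, h0, h⟩ := exists_common_wall ht (R.image (p ^ ·) ∪ R.image (q ^ ·)) (by
    intro g hg
    rcases Finset.mem_union.1 hg with hg | hg
    all_goals
      obtain ⟨i, -, rfl⟩ := Finset.mem_image.1 hg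
    exacts [hp.pow_right i, hq.pow_right i])
  refine ⟨n, H, h0, exists_smul_eq_of_forall_cross_ne_zero hp (n := n) fun i hi => h _ ?_,
    exists_smul_eq_of_forall_cross_ne_zero hq (n := n) fun i hi => h _ ?_⟩
  · exact Finset.mem_union_left _ (Finset.mem_image.2 ⟨i, by simp [R]; omega, rfl⟩)
  · exact Finset.mem_union_right _ (Finset.mem_image.2 ⟨i, by simp [R]; omega, rfl⟩)

theorem smul_smul_baseWall_eq_iff {g u : PCGroup Γ} {x : V} :
    g • u • baseWall Γ x = u • baseWall Γ x ↔ u⁻¹ * g * u ∈ par Γ (Γ.neighborSet x) := by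
  rw [smul_smul, smul_baseWall_eq_iff, ← inv_mem_iff]
  simp [mul_assoc]

/-! ### Centralizers of powers of generators -/

theorem mem_closedStar_self (y : V) : y ∈ Γ.closedStar y := Set.mem_insert _ _

theorem neighborSet_subset_closedStar (y : V) : Γ.neighborSet y ⊆ Γ.closedStar y :=
  Set.subset_insert _ _

theorem commute_of_mem_par_closedStar {y : V} {g : PCGroup Γ} (h : g ∈ par Γ (Γ.closedStar y)) :
    Commute (gen Γ y) g := by
  have : par Γ (Γ.closedStar y) ≤ Subgroup.centralizer {gen Γ y} := by
    rw [par_le_iff]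
    rintro v (rfl | hv)
    · rw [Subgroup.mem_centralizer_singleton_iff]
    · exact par_neighborSet_le_centralizer y (gen_mem_par hv)
  exact (Subgroup.mem_centralizer_singleton_iff.1 (this h)).symm

theorem not_isOfFinOrder_gen_zpow {y : V} {k : ℤ} (hk : k ≠ 0) :
    ¬ IsOfFinOrder (gen Γ y ^ k) := by
  intro h
  obtain ⟨n, hn, h1⟩ := isOfFinOrder_iff_pow_eq_one.1 h
  rw [← zpow_natCast, ← zpow_mul] at h1
  have := gen_zpow_eq_one h1
  rcases mul_eq_zero.1 this with h | h
  · exact hk h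
  · omega

/-- The centralizer of a nontrivial power of a generator is generated by its closed star. -/
theorem mem_par_closedStar_of_commute_zpow [Finite V] {y : V} {k : ℤ} (hk : k ≠ 0)
    {g : PCGroup Γ} (h : Commute (gen Γ y ^ k) g) : g ∈ par Γ (Γ.closedStar y) := by
  obtain ⟨n, H, h0, h1⟩ := exists_common_wall (not_isOfFinOrder_gen_zpow hk) {g} (by simpa using h)
  have hy : gen Γ y ∈ par Γ ({y} : Set V) := gen_mem_par (Set.mem_singleton y)
  have hm : (gen Γ y ^ k) ^ n ∈ par Γ ({y} : Set V) := pow_mem (zpow_mem hy k) n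
  obtain ⟨u, hu, z, hz, e1⟩ := exists_of_cross_ne_zero hm h0
  obtain ⟨u', hu', z', hz', e2⟩ := exists_of_cross_ne_zero hm (h1 g (by simp))
  rw [Set.mem_singleton_iff] at hz hz'
  subst hz hz'
  have hsub : par Γ ({z'} : Set V) ≤ par Γ (Γ.closedStar z') :=
    par_mono (Set.singleton_subset_iff.2 (mem_closedStar_self z'))
  rw [e1, inv_smul_eq_iff, smul_smul] at e2
  obtain ⟨-, hl⟩ := smul_baseWall_eq_iff.1 e2
  have hl' := par_mono (neighborSet_subset_closedStar z') hl
  have : g = u * (u⁻¹ * (g * u')) * u'⁻¹ := by group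
  rw [this]
  exact mul_mem (mul_mem (hsub hu) hl') (inv_mem (hsub hu'))

theorem mem_par_closedStar_iff [Finite V] {y : V} {g : PCGroup Γ} :
    g ∈ par Γ (Γ.closedStar y) ↔ Commute (gen Γ y) g :=
  ⟨commute_of_mem_par_closedStar,
    fun h => mem_par_closedStar_of_commute_zpow (k := 1) one_ne_zero (by simpa using h)⟩

theorem exists_zpow_mul_of_mem_par_closedStar {y : V} {g : PCGroup Γ}
    (h : g ∈ par Γ (Γ.closedStar y)) :
    ∃ (i : ℤ), ∃ m ∈ par Γ (Γ.neighborSet y), g = gen Γ y ^ i * m := by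
  induction h using Subgroup.closure_induction with
  | mem x hx =>
    obtain ⟨v, rfl | hv, rfl⟩ := hx
    · exact ⟨1, 1, one_mem _, by simp⟩
    · exact ⟨0, _, gen_mem_par hv, by simp⟩
  | one => exact ⟨0, 1, one_mem _, by simp⟩
  | mul a b _ _ ha hb =>
    obtain ⟨i, m, hm, rfl⟩ := ha
    obtain ⟨j, m', hm', rfl⟩ := hb
    refine ⟨i + j, m * m', mul_mem hm hm', ?_⟩
    have := ((commute_of_mem_par_neighborSet hm).zpow_left j).eq
    calc _ = gen Γ y ^ i * (m * gen Γ y ^ j) * m' := by group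
      _ = _ := by rw [← this, zpow_add]; group
  | inv a _ ha =>
    obtain ⟨i, m, hm, rfl⟩ := ha
    refine ⟨-i, m⁻¹, inv_mem hm, ?_⟩
    have := ((commute_of_mem_par_neighborSet hm).zpow_left i).eq
    rw [this, mul_inv_rev, zpow_neg]

/-! ### Elements of minimal length in a coset of a parabolic subgroup -/

theorem cross_eq_zero_of_forall_len_le {L : Set V} {t u : PCGroup Γ}
    (ht : ∀ u ∈ par Γ L, len t ≤ len (u * t)) (hu : u ∈ par Γ L) {y : V} (hy : y ∈ L) :
    cross t (u • baseWall Γ y) = 0 := by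
  by_contra h
  have h1 := len_conj_zpow_mul_lt h
  have h2 := ht _ (zpow_mem (mul_mem (mul_mem hu (gen_mem_par hy)) (inv_mem hu))
    (-cross t (u • baseWall Γ y)))
  omega

/-- The length is additive on products of an element of a parabolic subgroup with a shortest
element of a coset, because the latter crosses none of the hyperplanes of the subgroup. -/
theorem len_mul_of_forall_len_le {L : Set V} {t u : PCGroup Γ}
    (ht : ∀ u ∈ par Γ L, len t ≤ len (u * t)) (hu : u ∈ par Γ L) :
    len (u * t) = len u + len t := by
  refine geodesic_induction (p := fun u => len (u * t) = len u + len t) (by simp) ?_ hu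
  intro s hs u hu hl ih
  refine le_antisymm (len_mul_le _ _) ?_
  have h0 : cross u (wall Γ (flip s)) = 0 := by
    by_contra h
    have := len_lt_of_cross_ne_zero h
    rw [letter_flip, inv_inv] at this
    omega
  have h1 : cross t (u⁻¹ • wall Γ (flip s)) = 0 := by
    obtain ⟨n, hn⟩ := exists_wall_eq (Γ := Γ) (flip s)
    rw [hn, smul_smul]
    exact cross_eq_zero_of_forall_len_le ht
      (mul_mem (inv_mem hu) (zpow_mem (gen_mem_par hs) n)) hs
  have h2 := len_lt_of_cross_eq_zero (g := u * t) (s := flip s) (by rw [cross_mul, h0, h1]; rfl)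
  rw [letter_flip, inv_inv, ← mul_assoc] at h2
  omega

theorem len_mul_of_forall_len_le' {L : Set V} {t u : PCGroup Γ}
    (ht : ∀ u ∈ par Γ L, len t ≤ len (t * u)) (hu : u ∈ par Γ L) :
    len (t * u) = len t + len u := by
  have := len_mul_of_forall_len_le (t := t⁻¹) (u := u⁻¹) (L := L) (fun v hv => by
    have := ht v⁻¹ (inv_mem hv)
    rw [← len_inv (v * t⁻¹), mul_inv_rev, inv_inv, len_inv]
    exact this) (inv_mem hu)
  rw [← mul_inv_rev, len_inv, len_inv, len_inv] at this
  omega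

theorem exists_min_double_coset (L : Set V) (t : PCGroup Γ) :
    ∃ k ∈ par Γ L, ∃ k' ∈ par Γ L, ∀ u ∈ par Γ L, ∀ u' ∈ par Γ L,
      len (k * t * k') ≤ len (u * (k * t * k') * u') := by
  let S : Set ℕ := {n | ∃ k ∈ par Γ L, ∃ k' ∈ par Γ L, len (k * t * k') = n}
  have hS : S.Nonempty := ⟨_, 1, one_mem _, 1, one_mem _, rfl⟩
  obtain ⟨k, hk, k', hk', h⟩ := Nat.sInf_mem hS
  refine ⟨k, hk, k', hk', fun u hu u' hu' => ?_⟩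
  rw [h]
  exact Nat.sInf_le ⟨u * k, mul_mem hu hk, k' * u', mul_mem hk' hu', by simp only [mul_assoc]⟩

/-- Let `t` be shortest in its double coset of a parabolic subgroup `par L`. The elements of
`par L` which `t` conjugates into `par L` only involve generators commuting with all of `t`. -/
theorem mem_par_of_mul_eq_mul {L : Set V} {t : PCGroup Γ}
    (ht : ∀ u ∈ par Γ L, ∀ u' ∈ par Γ L, len t ≤ len (u * t * u'))
    {r : PCGroup Γ} (hr : r ∈ par Γ L) :
    (∃ r' ∈ par Γ L, r * t = t * r') →
      r ∈ par Γ {y | y ∈ L ∧ t ∈ par Γ (Γ.neighborSet y)} := by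
  have htl : ∀ u ∈ par Γ L, len t ≤ len (u * t) := fun u hu => by
    simpa using ht u hu 1 (one_mem _)
  have htr : ∀ u ∈ par Γ L, len t ≤ len (t * u) := fun u hu => by
    simpa using ht 1 (one_mem _) u hu
  refine geodesic_induction (p := fun r => (∃ r' ∈ par Γ L, r * t = t * r') →
      r ∈ par Γ {y | y ∈ L ∧ t ∈ par Γ (Γ.neighborSet y)}) (fun _ => one_mem _) ?_ hr
  rintro s hs r hr hl ih ⟨r', hr', e⟩
  obtain ⟨n, hn⟩ := exists_wall_eq (Γ := Γ) s
  have hsr : letter Γ s * r ∈ par Γ L := mul_mem (letter_mem_par hs) hr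
  have h1 : cross (letter Γ s * r) (wall Γ s) ≠ 0 := by
    intro h
    have := len_lt_of_cross_eq_zero h
    rw [inv_mul_cancel_left] at this
    omega
  have h2 : cross t ((letter Γ s * r)⁻¹ • wall Γ s) = 0 := by
    rw [hn, smul_smul]
    exact cross_eq_zero_of_forall_len_le htl
      (mul_mem (inv_mem hsr) (zpow_mem (gen_mem_par hs) n)) hs
  have h3 : cross t (wall Γ s) = 0 := by
    rw [hn]
    exact cross_eq_zero_of_forall_len_le htl (zpow_mem (gen_mem_par hs) n) hs
  have h4 : cross r' (t⁻¹ • wall Γ s) ≠ 0 := by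
    have h5 := cross_mul (letter Γ s * r) t (wall Γ s)
    have h6 := cross_mul t r' (wall Γ s)
    rw [e] at h5
    intro h
    rw [h3, h, add_zero] at h6
    rw [h2, h6, add_zero] at h5
    exact h1 h5.symm
  obtain ⟨u, hu, z, hz, e2⟩ := exists_of_cross_ne_zero hr' h4
  rw [hn, inv_smul_eq_iff, smul_smul] at e2
  obtain ⟨rfl, hm⟩ := smul_baseWall_eq_iff.1 e2
  have h5 : t * u ∈ par Γ (Γ.closedStar s.1) := by
    have : t * u = gen Γ s.1 ^ n * ((gen Γ s.1 ^ n)⁻¹ * (t * u)) := by group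
    rw [this]
    exact mul_mem (zpow_mem (gen_mem_par (mem_closedStar_self _)) n)
      (par_mono (neighborSet_subset_closedStar _) hm)
  have h6 := mem_par_of_mul_mem h5 (len_mul_of_forall_len_le' htr hu)
  obtain ⟨i, m, hmm, e3⟩ := exists_zpow_mul_of_mem_par_closedStar h6
  have h7 : t ∈ par Γ (Γ.neighborSet s.1) := by
    apply mem_par_of_len_le_len_retract
    have e4 : retract Γ (Γ.neighborSet s.1) t = gen Γ s.1 ^ (-i) * t := by
      rw [e3, map_mul, map_zpow, retract_gen_of_notMem (by simp), retract_of_mem hmm]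
      simp
    rw [e4]
    exact htl _ (zpow_mem (gen_mem_par hs) _)
  have hs' : s.1 ∈ {y | y ∈ L ∧ t ∈ par Γ (Γ.neighborSet y)} := ⟨hs, h7⟩
  refine mul_mem (letter_mem_par hs') (ih ⟨(letter Γ s)⁻¹ * r',
    mul_mem (inv_mem (letter_mem_par hs)) hr', ?_⟩)
  have hc : Commute (letter Γ s) t := by
    rw [letter_eq]
    exact (commute_of_mem_par_neighborSet h7).zpow_left _
  rw [← mul_assoc, ← hc.inv_left.eq, mul_assoc, ← e]
  group

/-! ### Centralizers of nonabelian subgroups -/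

/-- A parabolic subgroup on an independent set of vertices is free, hence torsion-free. -/
theorem eq_one_of_mem_par_of_isOfFinOrder {L : Set V} (hL : ∀ y ∈ L, ∀ z ∈ L, ¬ Γ.Adj y z)
    {g : PCGroup Γ} (hg : g ∈ par Γ L) (hfin : IsOfFinOrder g) : g = 1 := by
  classical
  let f : PCGroup Γ →* FreeGroup V := lift (fun v => if v ∈ L then FreeGroup.of v else 1) (by
    intro v w h
    split_ifs with h1 h2
    · exact absurd h (hL v h1 w h2)
    all_goals simp)
  have hf : par Γ L ≤ ((FreeGroup.lift (gen Γ)).comp f).eqLocus (MonoidHom.id _) := by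
    rw [par_le_iff]
    intro v hv
    change FreeGroup.lift (gen Γ) (f (gen Γ v)) = gen Γ v
    simp [f, hv]
  have h1 : f g = 1 := by
    obtain ⟨n, hn, e⟩ := isOfFinOrder_iff_pow_eq_one.1 hfin
    have : (f g) ^ n = 1 := by rw [← map_pow, e, map_one]
    exact (pow_eq_one_iff_left hn.ne').1 this
  have h2 : FreeGroup.lift (gen Γ) (f g) = g := hf hg
  rw [← h2, h1, map_one]

theorem commute_of_mem_par_of_subsingleton {A : Set V} (hA : A.Subsingleton) {a b : PCGroup Γ}
    (ha : a ∈ par Γ A) (hb : b ∈ par Γ A) : Commute a b := by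
  rcases hA.eq_empty_or_singleton with rfl | ⟨x, rfl⟩
  · rw [par_empty, Subgroup.mem_bot] at ha
    rw [ha]; exact Commute.one_left _
  · obtain ⟨m, rfl⟩ := mem_par_singleton.1 ha
    obtain ⟨n, rfl⟩ := mem_par_singleton.1 hb
    exact (Commute.refl _).zpow_zpow m n

/-- If `Γ` has no triangles and no squares, a nonabelian subgroup of the group
generated by the link of `x` has centralizer `⟨x⟩`. -/
theorem mem_par_singleton_of_commute [Finite V]
    (hT : ∀ x y z, Γ.Adj x y → Γ.Adj x z → ¬ Γ.Adj y z)
    (hS : ∀ y z, y ≠ z → ∀ x x', Γ.Adj y x → Γ.Adj z x → Γ.Adj y x' → Γ.Adj z x' → x = x')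
    {x : V} {t r s : PCGroup Γ} (hr : r ∈ par Γ (Γ.neighborSet x))
    (hs : s ∈ par Γ (Γ.neighborSet x)) (htr : Commute t r) (hts : Commute t s)
    (hrs : ∀ k m : ℕ, 0 < k → 0 < m → ¬ Commute (r ^ k) (s ^ m)) :
    t ∈ par Γ ({x} : Set V) := by
  have hL : ∀ y ∈ Γ.neighborSet x, ∀ z ∈ Γ.neighborSet x, ¬ Γ.Adj y z := fun y hy z hz =>
    hT x y z hy hz
  set L := Γ.neighborSet x
  obtain ⟨k, hk, k', hk', hmin⟩ := exists_min_double_coset L t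
  set t₀ := k * t * k'
  set L' : Set V := {y | y ∈ L ∧ t₀ ∈ par Γ (Γ.neighborSet y)}
  have hmem : ∀ r ∈ par Γ L, Commute t r → k * r * k⁻¹ ∈ par Γ L' := by
    intro r hr htr
    refine mem_par_of_mul_eq_mul hmin (mul_mem (mul_mem hk hr) (inv_mem hk))
      ⟨k'⁻¹ * r * k', mul_mem (mul_mem (inv_mem hk') hr) hk', ?_⟩
    calc k * r * k⁻¹ * (k * t * k') = k * (r * t) * k' := by group
      _ = _ := by rw [← htr.eq]; simp only [t₀]; group
  have hr' := hmem r hr htr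
  have hs' := hmem s hs hts
  have hns : ¬ L'.Subsingleton := by
    intro h
    have hc := commute_of_mem_par_of_subsingleton h hr' hs'
    have := hrs 1 1 one_pos one_pos
    rw [pow_one, pow_one] at this
    exact this ((Commute.conj_iff k).1 hc)
  rw [Set.not_subsingleton_iff] at hns
  obtain ⟨y, ⟨hy, hyt⟩, z, ⟨hz, hzt⟩, hyz⟩ := hns
  -- Two distinct elements of `L'` have only `x` as a common neighbour.
  have ht₀ : t₀ ∈ par Γ ({x} : Set V) := by
    refine par_mono ?_ (mem_par_inter hyt hzt)
    rintro w ⟨hw1, hw2⟩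
    exact hS y z hyz w x hw1 hw2 (SimpleGraph.Adj.symm hy) (SimpleGraph.Adj.symm hz)
  obtain ⟨i, hi⟩ := mem_par_singleton.1 ht₀
  have hxc : ∀ g ∈ par Γ L, Commute t₀ g := fun g hg => by
    rw [← hi]; exact (commute_of_mem_par_neighborSet hg).zpow_left i
  -- The remaining factor of `t` lies in the free group on the link of `x`.
  set κ := k⁻¹ * k'⁻¹
  have hκ : κ ∈ par Γ L := mul_mem (inv_mem hk) (inv_mem hk')
  have ht : t = t₀ * κ := by
    have : t = k⁻¹ * t₀ * k'⁻¹ := by simp only [t₀]; group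
    rw [this, ← (hxc _ (inv_mem hk)).eq, mul_assoc]
  have hκc : ∀ g ∈ par Γ L, Commute t g → Commute κ g := by
    intro g hg h
    have : κ = t₀⁻¹ * t := by rw [ht]; group
    rw [this]
    exact (hxc g hg).inv_left.mul_left h
  have hκ1 : κ = 1 := by
    by_contra hne
    have hinf : ¬ IsOfFinOrder κ := fun h => hne (eq_one_of_mem_par_of_isOfFinOrder hL hκ h)
    obtain ⟨n, H, h0, ⟨a, b, ha, e1⟩, c, d, hc, e2⟩ :=
      exists_wall_fixed hinf (hκc r hr htr) (hκc s hs hts)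
    obtain ⟨u, hu, w, hw, rfl⟩ := exists_of_cross_ne_zero (pow_mem hκ n) h0
    have key : ∀ g ∈ par Γ L, g • u • baseWall Γ w = u • baseWall Γ w → g = 1 := by
      intro g hg e
      rw [smul_smul_baseWall_eq_iff] at e
      have h1 := mem_par_inter (mul_mem (mul_mem (inv_mem hu) hg) hu) e
      have h2 : L ∩ Γ.neighborSet w = ∅ := by
        ext v
        simp only [Set.mem_inter_iff, Set.mem_empty_iff_false, iff_false, not_and]
        exact fun hv hv' => hL w hw v hv hv'
      rw [h2, par_empty, Subgroup.mem_bot] at h1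
      have : g = u * (u⁻¹ * g * u) * u⁻¹ := by group
      rw [this, h1]; group
    have k1 := key _ (mul_mem (pow_mem hr a) (zpow_mem hκ b)) e1
    have k2 := key _ (mul_mem (pow_mem hs c) (zpow_mem hκ d)) e2
    rw [mul_eq_one_iff_eq_inv] at k1 k2
    apply hrs a c ha hc
    rw [k1, k2]
    exact ((Commute.refl κ).zpow_zpow b d).inv_inv
  rw [ht, hκ1, mul_one]
  exact ht₀

/-- In the partially commutative group of a graph without triangles and squares, an element of
infinite order commuting with two elements without commuting powers is conjugate to a power of a
generator. -/
theorem exists_conj_zpow_of_commute [Finite V]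
    (hT : ∀ x y z, Γ.Adj x y → Γ.Adj x z → ¬ Γ.Adj y z)
    (hS : ∀ y z, y ≠ z → ∀ x x', Γ.Adj y x → Γ.Adj z x → Γ.Adj y x' → Γ.Adj z x' → x = x')
    {t p q : PCGroup Γ} (ht : ¬ IsOfFinOrder t) (hp : Commute t p) (hq : Commute t q)
    (hpq : ∀ k m : ℕ, 0 < k → 0 < m → ¬ Commute (p ^ k) (q ^ m)) :
    ∃ (u : PCGroup Γ) (x : V) (j : ℤ), t = u * gen Γ x ^ j * u⁻¹ := by
  obtain ⟨n, H, -, ⟨a, b, ha, e1⟩, c, d, hc, e2⟩ := exists_wall_fixed ht hp hq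
  obtain ⟨u, x, rfl⟩ := exists_smul_baseWall H
  rw [smul_smul_baseWall_eq_iff] at e1 e2
  have hconj : ∀ g : PCGroup Γ, Commute t g → Commute (u⁻¹ * t * u) (u⁻¹ * g * u) := by
    intro g hg
    have := (Commute.conj_iff u⁻¹).2 hg
    simpa using this
  have hmem := mem_par_singleton_of_commute hT hS (t := u⁻¹ * t * u) e1 e2
    (hconj _ ((hp.pow_right a).mul_right ((Commute.refl t).zpow_right b)))
    (hconj _ ((hq.pow_right c).mul_right ((Commute.refl t).zpow_right d))) (by
      intro k m hk hm h
      have h1 : Commute ((p ^ a * t ^ b) ^ k) ((q ^ c * t ^ d) ^ m) := by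
        have e : ∀ (g : PCGroup Γ) (k : ℕ), (u⁻¹ * g * u) ^ k = u⁻¹ * g ^ k * u := by
          intro g k
          have := conj_pow (i := k) (a := u⁻¹) (b := g)
          simpa using this
        rw [e, e] at h
        have := (Commute.conj_iff u⁻¹ (a := (p ^ a * t ^ b) ^ k) (b := (q ^ c * t ^ d) ^ m)).1
          (by simpa using h)
        exact this
      have cp : Commute (p ^ a) (t ^ b) := (hp.symm.pow_left a).zpow_right b
      have cq : Commute (q ^ c) (t ^ d) := (hq.symm.pow_left c).zpow_right d
      rw [cp.mul_pow, cq.mul_pow, ← pow_mul, ← pow_mul] at h1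
      apply hpq (a * k) (c * m) (Nat.mul_pos ha hk) (Nat.mul_pos hc hm)
      set P := p ^ (a * k)
      set Q := q ^ (c * m)
      have tP : Commute t P := hp.pow_right _
      have tQ : Commute t Q := hq.pow_right _
      have h2 : P = (P * (t ^ b) ^ k) * ((t ^ b) ^ k)⁻¹ := by group
      have h3 : Q = (Q * (t ^ d) ^ m) * ((t ^ d) ^ m)⁻¹ := by group
      have tt : ∀ i j : ℤ, ∀ k m : ℕ, Commute ((t ^ i) ^ k) ((t ^ j) ^ m) := fun i j k m =>
        ((Commute.refl t).zpow_zpow i j).pow_pow k m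
      have hPQ : Commute (P * (t ^ b) ^ k) Q := by
        rw [h3]
        refine h1.mul_right (Commute.inv_right ?_)
        exact (((tP.zpow_left d).pow_left m).symm).mul_left (tt b d k m)
      rw [h2]
      exact hPQ.mul_left (((tQ.zpow_left b).pow_left k).inv_left))
  obtain ⟨j, hj⟩ := mem_par_singleton.1 hmem
  exact ⟨u, x, j, by rw [hj]; group⟩

/-! ### The extension graph -/

/-- The vertices of the extension graph: conjugates of generators. Two of them are adjacent
when they are distinct and commute. -/
def IsVert (a : PCGroup Γ) : Prop := ∃ (g : PCGroup Γ) (y : V), a = g * gen Γ y * g⁻¹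

theorem isVert_gen (y : V) : IsVert (gen Γ y) := ⟨1, y, by simp⟩

theorem IsVert.conj {a : PCGroup Γ} (ha : IsVert a) (h : PCGroup Γ) : IsVert (h * a * h⁻¹) := by
  obtain ⟨g, y, rfl⟩ := ha
  exact ⟨h * g, y, by group⟩

theorem gen_mem_par_iff {A : Set V} {y : V} : gen Γ y ∈ par Γ A ↔ y ∈ A := by
  refine ⟨fun h => ?_, gen_mem_par⟩
  by_contra hy
  have := expo_eq_one_of_mem_par hy h
  rw [expo_gen_self] at this
  exact absurd this (by decide)

theorem commute_gen_iff [Finite V] {y z : V} :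
    Commute (gen Γ y) (gen Γ z) ↔ z ∈ Γ.closedStar y := by
  rw [← mem_par_closedStar_iff, gen_mem_par_iff]

theorem commute_conj_gen_iff [Finite V] {t : PCGroup Γ} {y z : V} :
    Commute (t * gen Γ y * t⁻¹) (t * gen Γ z * t⁻¹) ↔ z ∈ Γ.closedStar y := by
  rw [Commute.conj_iff, commute_gen_iff]

theorem IsVert.commute_of_zpow [Finite V] {a g : PCGroup Γ} (ha : IsVert a) {k : ℤ} (hk : k ≠ 0)
    (h : Commute (a ^ k) g) : Commute a g := by
  obtain ⟨t, y, rfl⟩ := ha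
  have h1 : Commute (gen Γ y ^ k) (t⁻¹ * g * t) := by
    rw [conj_zpow] at h
    rw [← Commute.conj_iff t]
    convert h using 1
    group
  have h2 := commute_of_mem_par_closedStar (mem_par_closedStar_of_commute_zpow hk h1)
  rw [← Commute.conj_iff t] at h2
  convert h2 using 1
  group

theorem IsVert.eq_of_conj_eq {g h : PCGroup Γ} {y z : V}
    (e : g * gen Γ y * g⁻¹ = h * gen Γ z * h⁻¹) : y = z := by
  by_contra hne
  have := congrArg (expo Γ y) e
  rw [expo_conj, expo_conj, expo_gen_self, expo_gen_of_ne (Ne.symm hne)] at this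
  exact absurd this (by decide)

/-- A conjugate of a generator lying in a parabolic subgroup is a conjugate of a generator within
that subgroup: apply the retraction. -/
theorem IsVert.exists_of_mem_par {a : PCGroup Γ} (ha : IsVert a) {A : Set V} (h : a ∈ par Γ A) :
    ∃ g ∈ par Γ A, ∃ y ∈ A, a = g * gen Γ y * g⁻¹ := by
  obtain ⟨t, y, rfl⟩ := ha
  have hy : y ∈ A := by
    by_contra hy
    have := expo_eq_one_of_mem_par hy h
    rw [expo_conj, expo_gen_self] at this
    exact absurd this (by decide)
  refine ⟨retract Γ A t, retract_mem A t, y, hy, ?_⟩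
  have := retract_of_mem h
  rw [map_mul, map_mul, map_inv, retract_gen_of_mem hy] at this
  exact this.symm

theorem IsVert.exists_common_translate [Finite V] {a b : PCGroup Γ} (ha : IsVert a)
    (hb : IsVert b) (h : Commute a b) :
    ∃ (t : PCGroup Γ) (y z : V), a = t * gen Γ y * t⁻¹ ∧ b = t * gen Γ z * t⁻¹ := by
  obtain ⟨g, y, rfl⟩ := ha
  have hb' : IsVert (g⁻¹ * b * g) := by simpa using hb.conj g⁻¹
  have h1 : Commute (gen Γ y) (g⁻¹ * b * g) := by
    rw [← Commute.conj_iff g]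
    convert h using 1
    group
  obtain ⟨u, hu, z, -, e⟩ := hb'.exists_of_mem_par (mem_par_closedStar_iff.2 h1)
  have hu' := commute_of_mem_par_closedStar hu
  refine ⟨g * u, y, z, ?_, ?_⟩
  · calc g * gen Γ y * g⁻¹ = g * (gen Γ y * u) * u⁻¹ * g⁻¹ := by group
      _ = _ := by rw [hu'.eq]; group
  · calc b = g * (g⁻¹ * b * g) * g⁻¹ := by group
      _ = _ := by rw [e]; group

theorem IsVert.eq_of_zpow_eq [Finite V] {a b : PCGroup Γ} (ha : IsVert a) (hb : IsVert b)
    {k l : ℤ} (hk : k ≠ 0) (e : a ^ k = b ^ l) : a = b := by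
  have h1 : Commute a b := by
    apply ha.commute_of_zpow hk
    rw [e]
    exact (Commute.refl b).zpow_left l
  obtain ⟨t, y, z, rfl, rfl⟩ := ha.exists_common_translate hb h1
  rw [conj_zpow, conj_zpow, mul_left_inj, mul_right_inj] at e
  by_cases hyz : y = z
  · rw [hyz]
  · have := congrArg (expo Γ y) e
    rw [expo_gen_zpow_self, map_zpow, expo_gen_of_ne (Ne.symm hyz), one_zpow, ofAdd_eq_one] at this
    exact absurd this hk

theorem IsVert.mem_par_neighborSet [Finite V] {a : PCGroup Γ} (ha : IsVert a) {x : V}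
    (h : Commute (gen Γ x) a) (hne : a ≠ gen Γ x) : a ∈ par Γ (Γ.neighborSet x) := by
  obtain ⟨u, hu, z, hz, e⟩ := ha.exists_of_mem_par (mem_par_closedStar_iff.2 h)
  rcases hz with rfl | hz
  · refine absurd ?_ hne
    rw [e, ← (commute_of_mem_par_closedStar hu).eq, mul_inv_cancel_right]
  · obtain ⟨i, m, hm, rfl⟩ := exists_zpow_mul_of_mem_par_closedStar hu
    have hmem : m * gen Γ z * m⁻¹ ∈ par Γ (Γ.neighborSet x) :=
      mul_mem (mul_mem hm (gen_mem_par hz)) (inv_mem hm)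
    have h2 := (commute_of_mem_par_neighborSet hmem).zpow_left i
    have : a = m * gen Γ z * m⁻¹ := by
      rw [e]
      calc _ = gen Γ x ^ i * (m * gen Γ z * m⁻¹) * (gen Γ x ^ i)⁻¹ := by group
        _ = _ := by rw [h2.eq, mul_inv_cancel_right]
    rw [this]; exact hmem

theorem commute_conj_left {g a b : PCGroup Γ} :
    Commute (g⁻¹ * a * g) b ↔ Commute a (g * b * g⁻¹) := by
  rw [← Commute.conj_iff g (a := g⁻¹ * a * g)]
  have : g * (g⁻¹ * a * g) * g⁻¹ = a := by group
  rw [this]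

/-- The extension graph has no squares: two vertices which are not adjacent have at most one common
neighbour. -/
theorem IsVert.eq_of_commute [Finite V]
    (hT : ∀ x y z, Γ.Adj x y → Γ.Adj x z → ¬ Γ.Adj y z)
    (hS : ∀ y z, y ≠ z → ∀ x x', Γ.Adj y x → Γ.Adj z x → Γ.Adj y x' → Γ.Adj z x' → x = x')
    {a b c c' : PCGroup Γ} (ha : IsVert a) (hb : IsVert b) (hc : IsVert c) (hc' : IsVert c')
    (hab : ¬ Commute a b) (hca : Commute c a) (hcb : Commute c b) (hca' : Commute c' a)
    (hcb' : Commute c' b) : c = c' := by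
  obtain ⟨u, x, rfl⟩ := hc
  have conj : ∀ {p q : PCGroup Γ}, Commute p q ↔ Commute (u⁻¹ * p * u) (u⁻¹ * q * u) := by
    intro p q
    have := Commute.conj_iff u⁻¹ (a := p) (b := q)
    rw [inv_inv] at this
    exact this.symm
  have ha1 : IsVert (u⁻¹ * a * u) := by simpa using ha.conj u⁻¹
  have hb1 : IsVert (u⁻¹ * b * u) := by simpa using hb.conj u⁻¹
  have hc1 : IsVert (u⁻¹ * c' * u) := by simpa using hc'.conj u⁻¹
  have e : u⁻¹ * (u * gen Γ x * u⁻¹) * u = gen Γ x := by group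
  rw [conj] at hab hca hcb hca' hcb'
  rw [e] at hca hcb
  set a' := u⁻¹ * a * u
  set b' := u⁻¹ * b * u
  have hpow : ∀ k m : ℕ, 0 < k → 0 < m → ¬ Commute (a' ^ k) (b' ^ m) := by
    intro k m hk hm h
    rw [← zpow_natCast, ← zpow_natCast] at h
    have h1 := ha1.commute_of_zpow (by omega) h
    exact hab (hb1.commute_of_zpow (by omega) h1.symm).symm
  have h1 := mem_par_singleton_of_commute hT hS
    (ha1.mem_par_neighborSet hca (by intro h; rw [h] at hab; exact hab hcb))
    (hb1.mem_par_neighborSet hcb (by intro h; rw [h] at hab; exact hab hca.symm))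
    hca' hcb' hpow
  obtain ⟨v, hv, y, hy, e2⟩ := hc1.exists_of_mem_par h1
  rw [Set.mem_singleton_iff] at hy
  subst hy
  obtain ⟨n, rfl⟩ := mem_par_singleton.1 hv
  have e3 : u⁻¹ * c' * u = gen Γ y := by
    rw [e2]; group
  rw [← e3]; group

/-- A vertex of the extension graph outside the copy of `Γ` given by the generators is adjacent to
at most one of them. -/
theorem IsVert.eq_of_commute_gen [Finite V]
    (hS : ∀ y z, y ≠ z → ∀ x x', Γ.Adj y x → Γ.Adj z x → Γ.Adj y x' → Γ.Adj z x' → x = x')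
    {d : PCGroup Γ} (hd : IsVert d) (hr : d ∉ Set.range (gen Γ)) {y z : V}
    (hy : Commute d (gen Γ y)) (hz : Commute d (gen Γ z)) : y = z := by
  by_contra hne
  obtain ⟨h, hh, w, hw, rfl⟩ := hd.exists_of_mem_par (mem_par_inter
    (mem_par_closedStar_iff.2 hy.symm) (mem_par_closedStar_iff.2 hz.symm))
  have hsub : Γ.closedStar y ∩ Γ.closedStar z ⊆ Γ.closedStar w := by
    rintro v ⟨hv1, hv2⟩
    obtain ⟨hw1, hw2⟩ := hw
    rcases hw1 with rfl | hw1
    · exact hv1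
    rcases hw2 with rfl | hw2
    · exact hv2
    rcases hv1 with rfl | hv1
    · exact Or.inr (SimpleGraph.Adj.symm hw1)
    rcases hv2 with rfl | hv2
    · exact Or.inr (SimpleGraph.Adj.symm hw2)
    exact Or.inl (hS y z hne v w hv1 hv2 hw1 hw2)
  apply hr
  refine ⟨w, ?_⟩
  rw [← (commute_of_mem_par_closedStar (par_mono hsub hh)).eq, mul_inv_cancel_right]

/-! ### Separation by stars in the extension graph -/

/-- `Linked c a b`: the vertices `a` and `b` of the extension graph are joined by a path avoiding
the closed star of `c`. -/
def Linked (c : PCGroup Γ) : PCGroup Γ → PCGroup Γ → Prop :=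
  Relation.ReflTransGen fun a b =>
    IsVert a ∧ IsVert b ∧ ¬ Commute c a ∧ ¬ Commute c b ∧ Commute a b

theorem Linked.symm {c a b : PCGroup Γ} (h : Linked c a b) : Linked c b a := by
  induction h with
  | refl => exact .refl
  | tail _ hst ih =>
    obtain ⟨h1, h2, h3, h4, h5⟩ := hst
    exact .head ⟨h2, h1, h4, h3, h5.symm⟩ ih

theorem Linked.trans {c a b d : PCGroup Γ} (h : Linked c a b) (h' : Linked c b d) :
    Linked c a d := Relation.ReflTransGen.trans h h'

theorem Linked.map {c a b : PCGroup Γ} (h : Linked c a b) {f : PCGroup Γ → PCGroup Γ}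
    (hc : IsVert c) (hf : ∀ a, IsVert a → IsVert (f a))
    (hf' : ∀ a b, IsVert a → IsVert b → (Commute (f a) (f b) ↔ Commute a b)) :
    Linked (f c) (f a) (f b) := by
  induction h with
  | refl => exact .refl
  | tail _ hst ih =>
    obtain ⟨h1, h2, h3, h4, h5⟩ := hst
    exact .tail ih
      ⟨hf _ h1, hf _ h2, by rwa [hf' _ _ hc h1], by rwa [hf' _ _ hc h2], by rwa [hf' _ _ h1 h2]⟩

theorem Linked.conj {c a b : PCGroup Γ} (h : Linked c a b) (hc : IsVert c) (g : PCGroup Γ) :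
    Linked (g * c * g⁻¹) (g * a * g⁻¹) (g * b * g⁻¹) :=
  h.map (f := fun a => g * a * g⁻¹) hc (fun _ ha => ha.conj g) (fun _ _ _ _ => Commute.conj_iff g)

/-- The side of a wall on which a vertex of the extension graph lies is well defined. -/
theorem cross_eq_of_conj_eq [Finite V] {s : V × Bool} {g h : PCGroup Γ} {y z : V}
    (e : g * gen Γ y * g⁻¹ = h * gen Γ z * h⁻¹)
    (hn : ¬ Commute (gen Γ s.1) (g * gen Γ y * g⁻¹)) :
    cross g (wall Γ s) = cross h (wall Γ s) := by
  obtain rfl := IsVert.eq_of_conj_eq e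
  have hm : g⁻¹ * h ∈ par Γ (Γ.closedStar y) := by
    rw [mem_par_closedStar_iff]
    change _ = _
    calc gen Γ y * (g⁻¹ * h) = g⁻¹ * (g * gen Γ y * g⁻¹) * h := by group
      _ = _ := by rw [e]; group
  have hh : h = g * (g⁻¹ * h) := by group
  rw [hh, cross_mul, left_eq_add]
  by_contra hne
  obtain ⟨u, hu, w, hw, e2⟩ := exists_of_cross_ne_zero hm hne
  rw [inv_smul_eq_iff, smul_smul] at e2
  have e3 := conj_eq_of_wall_eq e2.symm
  apply hn
  have e4 : g * gen Γ y * g⁻¹ = (g * u) * gen Γ y * (g * u)⁻¹ := by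
    have := (commute_of_mem_par_closedStar hu).eq
    calc g * gen Γ y * g⁻¹ = g * (gen Γ y * u) * u⁻¹ * g⁻¹ := by group
      _ = _ := by rw [this]; group
  rw [← e3, e4]
  exact (commute_conj_gen_iff.2 hw).symm

theorem Linked.cross_eq [Finite V] {s : V × Bool} {a b : PCGroup Γ}
    (hl : Linked (gen Γ s.1) a b) (hn : ¬ Commute (gen Γ s.1) a) {g h : PCGroup Γ} {y z : V}
    (ha : a = g * gen Γ y * g⁻¹) (hb : b = h * gen Γ z * h⁻¹) :
    cross g (wall Γ s) = cross h (wall Γ s) := by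
  induction hl generalizing h z with
  | refl => subst ha; exact cross_eq_of_conj_eq hb hn
  | tail _ hst ih =>
    obtain ⟨h1, h2, h3, h4, h5⟩ := hst
    obtain ⟨t, y', z', e1, e2⟩ := h1.exists_common_translate h2 h5
    rw [ih e1]
    rw [hb] at e2 h4
    exact (cross_eq_of_conj_eq e2 h4).symm

theorem exists_first_letter {g : PCGroup Γ} (hg : g ≠ 1) :
    ∃ s : V × Bool, len ((letter Γ s)⁻¹ * g) < len g := by
  obtain ⟨w, rfl, hw⟩ := exists_geodesic g
  cases w with
  | nil => exact absurd rfl hg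
  | cons s w =>
    refine ⟨s, ?_⟩
    rw [← hw, wordProd_cons, inv_mul_cancel_left]
    exact (len_wordProd_le w).trans_lt (by simp)

/-- The distance in the Cayley graph from `1` to the set of `g` such that `a` lies in the translate
by `g` of the copy of `Γ` given by the generators. -/
noncomputable def depth (a : PCGroup Γ) : ℕ :=
  sInf {n | ∃ (g : PCGroup Γ) (y : V), a = g * gen Γ y * g⁻¹ ∧ len g = n}

theorem depth_le {a g : PCGroup Γ} {y : V} (h : a = g * gen Γ y * g⁻¹) : depth a ≤ len g :=
  Nat.sInf_le ⟨g, y, h, rfl⟩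

theorem IsVert.exists_depth {a : PCGroup Γ} (ha : IsVert a) :
    ∃ (g : PCGroup Γ) (y : V), a = g * gen Γ y * g⁻¹ ∧ len g = depth a := by
  obtain ⟨g, y, h⟩ := ha
  exact Nat.sInf_mem
    (s := {n | ∃ (g : PCGroup Γ) (y : V), a = g * gen Γ y * g⁻¹ ∧ len g = n}) ⟨_, g, y, h, rfl⟩

/-- `InTranslate h a`: the vertex `a` lies in the conjugate by `h` of the copy of `Γ` given by the
generators. -/
def InTranslate (h a : PCGroup Γ) : Prop := ∃ y : V, a = h * gen Γ y * h⁻¹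

/-- A finite set of vertices of the extension graph lies in a single translate of `Γ`, unless it is
separated by the star of a vertex; the translate containing that vertex can be chosen to
contain as much of the finite set as any given translate. It is reached from the given translate by
moving towards the finite set, across walls which do not separate it. -/
theorem exists_translate [Finite V] {ι : Type*} [Finite ι] (K : ι → PCGroup Γ)
    (hK : ∀ i, IsVert (K i)) (h₀ : PCGroup Γ) :
    ∃ h : PCGroup Γ, (∀ i, InTranslate h₀ (K i) → InTranslate h (K i)) ∧
      ((∀ i, InTranslate h (K i)) ∨ ∃ (x : V) (i j : ι),
        ¬ Commute (h * gen Γ x * h⁻¹) (K i) ∧ ¬ Commute (h * gen Γ x * h⁻¹) (K j) ∧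
        ¬ Linked (h * gen Γ x * h⁻¹) (K i) (K j)) := by
  cases nonempty_fintype ι
  induction hn : ∑ i, depth (h₀⁻¹ * K i * h₀) using Nat.strong_induction_on generalizing h₀ with
  | _ n ih =>
  by_cases hall : ∀ i, InTranslate h₀ (K i)
  · exact ⟨h₀, fun _ h => h, Or.inl hall⟩
  push Not at hall
  obtain ⟨i, hi⟩ := hall
  set K' : ι → PCGroup Γ := fun j => h₀⁻¹ * K j * h₀ with hK'def
  have hK' : ∀ j, IsVert (K' j) := fun j => by simpa using (hK j).conj h₀⁻¹
  have hKK' : ∀ j, K j = h₀ * K' j * h₀⁻¹ := fun j => by simp only [hK'def]; group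
  obtain ⟨g, y, e, hg⟩ := (hK' i).exists_depth
  have hg1 : g ≠ 1 := by
    rintro rfl
    refine hi ⟨y, ?_⟩
    rw [hKK', e]; group
  obtain ⟨s, hs⟩ := exists_first_letter hg1
  have hlc : Commute (letter Γ s) (gen Γ s.1) := by
    rw [letter_eq]; exact (Commute.refl _).zpow_left _
  have hlc' : ∀ {a : PCGroup Γ}, Commute (gen Γ s.1) a → (letter Γ s)⁻¹ * a * letter Γ s = a := by
    intro a ha
    have : Commute (letter Γ s) a := by rw [letter_eq]; exact ha.zpow_left _
    rw [mul_assoc, ← this.eq, inv_mul_cancel_left]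
  -- A vertex whose star crosses the wall of `s` would not need `s` on a shortest path to it.
  have hnc : ¬ Commute (gen Γ s.1) (K' i) := by
    intro hc
    have h1 := hlc' hc
    rw [e] at h1
    have h2 : depth (K' i) ≤ len ((letter Γ s)⁻¹ * g) := by
      apply depth_le (y := y)
      rw [e, ← h1]; group
    omega
  have hcg : cross g (wall Γ s) ≠ 0 := by
    intro h
    have := len_lt_of_cross_eq_zero h
    omega
  by_cases hex : ∃ j, ¬ Commute (gen Γ s.1) (K' j) ∧ ¬ Linked (gen Γ s.1) (K' i) (K' j)
  · obtain ⟨j, hj1, hj2⟩ := hex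
    refine ⟨h₀, fun _ h => h, Or.inr ⟨s.1, i, j, ?_, ?_, ?_⟩⟩
    · rwa [hKK', Commute.conj_iff]
    · rwa [hKK', Commute.conj_iff]
    · intro h
      apply hj2
      have := h.conj ((isVert_gen s.1).conj h₀) h₀⁻¹
      simpa [hK'def, mul_assoc] using this
  · -- The wall of `s` separates nothing, so the translate by `h₀ * s` is closer to the set: each
    -- `K' j` either commutes with `s`, hence with no change of depth, or lies beyond the wall.
    push Not at hex
    have hconj : ∀ j, (h₀ * letter Γ s)⁻¹ * K j * (h₀ * letter Γ s) =
        (letter Γ s)⁻¹ * K' j * letter Γ s := fun j => by simp only [hK'def]; group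
    have hfar : ∀ j, ¬ Commute (gen Γ s.1) (K' j) → ∀ p z, K' j = p * gen Γ z * p⁻¹ →
        len ((letter Γ s)⁻¹ * p) < len p := by
      intro j hj p z hp
      apply len_lt_of_cross_ne_zero
      rwa [← (hex j hj).cross_eq hnc e hp]
    have hfar' : ∀ j, ¬ Commute (gen Γ s.1) (K' j) →
        depth ((letter Γ s)⁻¹ * K' j * letter Γ s) < depth (K' j) := by
      intro j hj
      obtain ⟨p, z, hp, hl⟩ := (hK' j).exists_depth
      rw [← hl]
      refine lt_of_le_of_lt ?_ (hfar j hj p z hp)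
      apply depth_le (y := z)
      rw [hp]; group
    have hlt : ∑ j, depth ((h₀ * letter Γ s)⁻¹ * K j * (h₀ * letter Γ s)) < n := by
      rw [← hn]
      refine Finset.sum_lt_sum (fun j _ => ?_) ⟨i, Finset.mem_univ _, ?_⟩
      · rw [hconj]
        by_cases hj : Commute (gen Γ s.1) (K' j)
        · rw [hlc' hj]
        · exact (hfar' j hj).le
      · rw [hconj]; exact hfar' i hnc
    obtain ⟨h, h1, h2⟩ := ih _ hlt (h₀ * letter Γ s) rfl
    refine ⟨h, fun j hj => h1 j ?_, h2⟩
    obtain ⟨z, hz⟩ := hj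
    have hz' : K' j = gen Γ z := by simp only [hK'def]; rw [hz]; group
    have hcj : Commute (gen Γ s.1) (K' j) := by
      by_contra hcj
      have := hfar j hcj 1 z (by rw [hz']; group)
      simp at this
    have h4 : letter Γ s * K' j * (letter Γ s)⁻¹ = K' j := by
      conv_lhs => rw [← hlc' hcj]
      group
    refine ⟨z, ?_⟩
    rw [hKK', ← hz']
    calc h₀ * K' j * h₀⁻¹ = h₀ * (letter Γ s * K' j * (letter Γ s)⁻¹) * h₀⁻¹ := by rw [h4]
      _ = _ := by group

end PCGroup

/-! ### Atomic graphs -/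

namespace SimpleGraph.IsAtomic

variable {V : Type*} {Γ : SimpleGraph V}

theorem not_adj_of_adj_adj (hΓ : Γ.IsAtomic) (x y z : V) (hxy : Γ.Adj x y) (hxz : Γ.Adj x z) :
    ¬ Γ.Adj y z := by
  intro hyz
  have h := hΓ.no_short_cycle x (.cons hxy (.cons hyz (.cons hxz.symm .nil))) (by
    have h1 := hxy.ne
    have h2 := hxz.ne
    have h3 := hyz.ne
    simp [Walk.cons_isCycle_iff, h1, h1.symm, h2, h2.symm, h3])
  simp at h

theorem eq_of_adj_adj (hΓ : Γ.IsAtomic) (y z : V) (hyz : y ≠ z) (x x' : V) (hyx : Γ.Adj y x)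
    (hzx : Γ.Adj z x) (hyx' : Γ.Adj y x') (hzx' : Γ.Adj z x') : x = x' := by
  by_contra hne
  have h := hΓ.no_short_cycle y (.cons hyx (.cons hzx.symm (.cons hzx' (.cons hyx'.symm .nil)))) (by
    have h1 := hyx.ne
    have h2 := hzx.ne
    have h3 := hyx'.ne
    have h4 := hzx'.ne
    simp [Walk.cons_isCycle_iff, h1, h1.symm, h2.symm, h3, h3.symm, h4, hne, hyz, hyz.symm])
  simp at h

theorem exists_adj_ne (hΓ : Γ.IsAtomic) [Nontrivial V] (v x : V) : ∃ u, Γ.Adj v u ∧ u ≠ x := by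
  obtain ⟨u, hu⟩ : ∃ u, Γ.Adj v u := hΓ.connected.preconnected.exists_adj_of_nontrivial v
  by_contra hcon
  push Not at hcon
  apply hΓ.no_valence_one v
  rw [Set.encard_eq_one]
  refine ⟨x, Set.eq_singleton_iff_unique_mem.2 ⟨?_, hcon⟩⟩
  rwa [← hcon u hu]

/-- Neither closed stars nor single vertices separate an atomic graph. -/
theorem joined_outside (hΓ : Γ.IsAtomic) [Nontrivial V] {T : Set V}
    (hT : T.Subsingleton ∨ ∃ x, T = Γ.closedStar x) {y z : V} (hy : y ∉ T) (hz : z ∉ T) :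
    Relation.ReflTransGen (fun a b => Γ.Adj a b ∧ a ∉ T ∧ b ∉ T) y z := by
  have star : ∀ x y z, y ∉ Γ.closedStar x → z ∉ Γ.closedStar x →
      Relation.ReflTransGen (fun a b => Γ.Adj a b ∧ a ∉ Γ.closedStar x ∧ b ∉ Γ.closedStar x)
        y z := by
    intro x y z hy hz
    have h := hΓ.no_separating_star x ⟨y, hy⟩ ⟨z, hz⟩
    rw [SimpleGraph.reachable_iff_reflTransGen] at h
    generalize hy' : (⟨y, hy⟩ : ↥(Γ.closedStar x)ᶜ) = y' at h
    generalize hz' : (⟨z, hz⟩ : ↥(Γ.closedStar x)ᶜ) = z' at h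
    have : Relation.ReflTransGen
        (fun a b => Γ.Adj a b ∧ a ∉ Γ.closedStar x ∧ b ∉ Γ.closedStar x) y'.1 z'.1 := by
      clear hy' hz'
      induction h with
      | refl => exact .refl
      | @tail b c _ hbc ih => exact .tail ih ⟨hbc, b.2, c.2⟩
    rw [← hy', ← hz'] at this
    exact this
  rcases hT with hT | ⟨x, rfl⟩
  · rcases hT.eq_empty_or_singleton with rfl | ⟨x, rfl⟩
    · have h := hΓ.connected.preconnected y z
      rw [SimpleGraph.reachable_iff_reflTransGen] at h
      exact Relation.ReflTransGen.mono (fun a b hab => ⟨hab, by simp, by simp⟩) y z h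
    · -- Every vertex other than `x` is, or is adjacent to, a vertex outside the star of `x`.
      have out : ∀ v, v ∉ ({x} : Set V) → ∃ u, u ∉ Γ.closedStar x ∧ (u = v ∨ Γ.Adj v u) := by
        intro v hv
        by_cases h : v ∈ Γ.closedStar x
        · rcases h with rfl | h
          · exact absurd rfl hv
          · obtain ⟨u, hu, hux⟩ := hΓ.exists_adj_ne v x
            refine ⟨u, ?_, Or.inr hu⟩
            rintro (rfl | hxu)
            · exact hux rfl
            · exact hΓ.not_adj_of_adj_adj x v u h hxu hu
        · exact ⟨v, h, Or.inl rfl⟩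
      have hsub : ∀ {u}, u ∉ Γ.closedStar x → u ∉ ({x} : Set V) := fun hu h =>
        hu (Or.inl h)
      obtain ⟨u, hu, hyu⟩ := out y hy
      obtain ⟨w, hw, hzw⟩ := out z hz
      have h1 : Relation.ReflTransGen (fun a b => Γ.Adj a b ∧ a ∉ ({x} : Set V) ∧ b ∉ ({x} : Set V))
          u w :=
        Relation.ReflTransGen.mono (fun a b hab => ⟨hab.1, hsub hab.2.1, hsub hab.2.2⟩)
          u w (star x u w hu hw)
      refine Relation.ReflTransGen.trans ?_ (h1.trans ?_)
      · rcases hyu with rfl | hyu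
        · exact .refl
        · exact .single ⟨hyu, hy, hsub hu⟩
      · rcases hzw with rfl | hzw
        · exact .refl
        · exact .single ⟨hzw.symm, hsub hw, hz⟩
  · exact star x y z hy hz

end SimpleGraph.IsAtomic

namespace PCGroup

variable {V : Type*} {Γ : SimpleGraph V}

/-! ### Copies of an atomic graph in the extension graph -/

/-- A map of `V` into the extension graph which is an isomorphism onto an induced subgraph. -/
structure IsCopy (K : V → PCGroup Γ) : Prop where
  isVert : ∀ v, IsVert (K v)
  commute_iff : ∀ v w, Commute (K v) (K w) ↔ w ∈ Γ.closedStar v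
  injective : Function.Injective K

theorem IsCopy.linked [Nontrivial V] (hΓ : Γ.IsAtomic) {K : V → PCGroup Γ} (hK : IsCopy K)
    {c : PCGroup Γ}
    (hT : {v | Commute c (K v)}.Subsingleton ∨ ∃ x, {v | Commute c (K v)} = Γ.closedStar x)
    {v w : V} (hv : ¬ Commute c (K v)) (hw : ¬ Commute c (K w)) : Linked c (K v) (K w) := by
  induction hΓ.joined_outside hT hv hw with
  | refl => exact .refl
  | tail _ hst ih =>
    obtain ⟨h1, h2, h3⟩ := hst
    exact .tail (ih h2) ⟨hK.isVert _, hK.isVert _, h2, h3, (hK.commute_iff _ _).2 (Or.inr h1)⟩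

theorem isCopy_gen [Finite V] : IsCopy (gen Γ) :=
  ⟨isVert_gen, fun _ _ => commute_gen_iff, gen_injective⟩

/-- No star separates two vertices of a translate of `Γ`. -/
theorem linked_of_translate [Finite V] [Nontrivial V] (hΓ : Γ.IsAtomic) {d h : PCGroup Γ}
    (hd : IsVert d) {y z : V} (hy : ¬ Commute d (h * gen Γ y * h⁻¹))
    (hz : ¬ Commute d (h * gen Γ z * h⁻¹)) :
    Linked d (h * gen Γ y * h⁻¹) (h * gen Γ z * h⁻¹) := by
  have hd' : IsVert (h⁻¹ * d * h) := by simpa using hd.conj h⁻¹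
  rw [← commute_conj_left] at hy hz
  have key : Linked (h⁻¹ * d * h) (gen Γ y) (gen Γ z) := by
    refine isCopy_gen.linked hΓ ?_ hy hz
    by_cases hr : h⁻¹ * d * h ∈ Set.range (gen Γ)
    · obtain ⟨x, hx⟩ := hr
      right
      refine ⟨x, ?_⟩
      ext v
      rw [← hx]
      exact commute_gen_iff
    · exact Or.inl fun v hv w hw => hd'.eq_of_commute_gen hΓ.eq_of_adj_adj hr hv hw
  have := key.conj hd' h
  have e : h * (h⁻¹ * d * h) * h⁻¹ = d := by group
  rwa [e] at this

/-- A star separating a copy of an atomic graph is centred outside the copy and contains two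
nonadjacent vertices of it. -/
theorem IsCopy.exists_of_not_linked [Finite V] [Nontrivial V] (hΓ : Γ.IsAtomic) {K : V → PCGroup Γ}
    (hK : IsCopy K) {c : PCGroup Γ} (hc : IsVert c) {v w : V} (hv : ¬ Commute c (K v))
    (hw : ¬ Commute c (K w)) (h : ¬ Linked c (K v) (K w)) :
    c ∉ Set.range K ∧
      ∃ s s', Commute c (K s) ∧ Commute c (K s') ∧ ¬ Commute (K s) (K s') := by
  have hr : c ∉ Set.range K := by
    rintro ⟨x, rfl⟩
    exact h (hK.linked hΓ (Or.inr ⟨x, Set.ext fun v => hK.commute_iff x v⟩) hv hw)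
  refine ⟨hr, ?_⟩
  have hns : ¬ {v | Commute c (K v)}.Subsingleton := fun hs => h (hK.linked hΓ (Or.inl hs) hv hw)
  rw [Set.not_subsingleton_iff] at hns
  obtain ⟨s, hs, s', hs', hne⟩ := hns
  refine ⟨s, s', hs, hs', fun hcomm => hr ?_⟩
  obtain ⟨t, y, z, e1, e2⟩ := (hK.isVert s).exists_common_translate (hK.isVert s') hcomm
  have hyz : y ≠ z := by
    rintro rfl
    exact hne (hK.injective (e1.trans e2.symm))
  have hs1 : Commute (t⁻¹ * c * t) (gen Γ y) := by
    rw [commute_conj_left, ← e1]; exact hs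
  have hs2 : Commute (t⁻¹ * c * t) (gen Γ z) := by
    rw [commute_conj_left, ← e2]; exact hs'
  have hadj : Γ.Adj y z := by
    rw [e1, e2, commute_conj_gen_iff] at hcomm
    rcases hcomm with rfl | h
    · exact absurd rfl hyz
    · exact h
  have hmem : t⁻¹ * c * t ∈ Set.range (gen Γ) := by
    by_contra hnr
    have hc' : IsVert (t⁻¹ * c * t) := by simpa using hc.conj t⁻¹
    exact hyz (hc'.eq_of_commute_gen hΓ.eq_of_adj_adj hnr hs1 hs2)
  obtain ⟨x, hx⟩ := hmem
  have hcx : c = t * gen Γ x * t⁻¹ := by rw [hx]; group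
  rw [← hx, commute_gen_iff] at hs1 hs2
  rcases hs1 with rfl | hs1
  · exact ⟨s, by rw [e1, hcx]⟩
  rcases hs2 with rfl | hs2
  · exact ⟨s', by rw [e2, hcx]⟩
  exact absurd hadj (hΓ.not_adj_of_adj_adj x y z hs1 hs2)

/-! ### Self-maps of the extension graph -/

/-- Self-maps of the extension graph which are isomorphisms onto an induced subgraph and carry
translates to translates. -/
structure IsVertMap (φ : PCGroup Γ → PCGroup Γ) : Prop where
  isVert : ∀ a, IsVert a → IsVert (φ a)
  commute_iff : ∀ a b, IsVert a → IsVert b → (Commute (φ a) (φ b) ↔ Commute a b)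
  injOn : ∀ a b, IsVert a → IsVert b → φ a = φ b → a = b
  conj : ∀ h, ∃ h', ∀ a, IsVert a → φ (h * a * h⁻¹) = h' * φ a * h'⁻¹

theorem IsVertMap.iterate {φ : PCGroup Γ → PCGroup Γ} (hφ : IsVertMap φ) (n : ℕ) :
    IsVertMap φ^[n] := by
  induction n with
  | zero => exact ⟨fun _ h => h, fun _ _ _ _ => Iff.rfl, fun _ _ _ _ h => h,
      fun h => ⟨h, fun _ _ => rfl⟩⟩
  | succ n ih =>
    simp only [Function.iterate_succ']
    refine ⟨fun a ha => hφ.isVert _ (ih.isVert a ha), fun a b ha hb => ?_, fun a b ha hb e => ?_,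
      fun h => ?_⟩
    · exact (hφ.commute_iff _ _ (ih.isVert a ha) (ih.isVert b hb)).trans (ih.commute_iff a b ha hb)
    · exact ih.injOn a b ha hb (hφ.injOn _ _ (ih.isVert a ha) (ih.isVert b hb) e)
    · obtain ⟨h', hh'⟩ := ih.conj h
      obtain ⟨h'', hh''⟩ := hφ.conj h'
      refine ⟨h'', fun a ha => ?_⟩
      simp only [Function.comp_apply]
      rw [hh' a ha, hh'' _ (ih.isVert a ha)]

theorem IsVertMap.isCopy [Finite V] {φ : PCGroup Γ → PCGroup Γ} (hφ : IsVertMap φ) :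
    IsCopy fun v => φ (gen Γ v) :=
  ⟨fun v => hφ.isVert _ (isVert_gen v),
    fun v w => (hφ.commute_iff _ _ (isVert_gen v) (isVert_gen w)).trans commute_gen_iff,
    fun v w e => gen_injective (hφ.injOn _ _ (isVert_gen v) (isVert_gen w) e)⟩

theorem IsVertMap.linked {φ : PCGroup Γ → PCGroup Γ} (hφ : IsVertMap φ) {c a b : PCGroup Γ}
    (h : Linked c a b) (hc : IsVert c) : Linked (φ c) (φ a) (φ b) :=
  h.map hc hφ.isVert hφ.commute_iff

/-- Some iterate of a self-map of the extension graph of an atomic graph maps `Γ` onto a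
translate. -/
theorem IsVertMap.exists_iterate_inTranslate [Finite V] [Nontrivial V] (hΓ : Γ.IsAtomic)
    {φ : PCGroup Γ → PCGroup Γ} (hφ : IsVertMap φ) :
    ∃ (N : ℕ) (h : PCGroup Γ), ∀ v, InTranslate h (φ^[N + 1] (gen Γ v)) := by
  set K : ℕ → V → PCGroup Γ := fun n v => φ^[n] (gen Γ v) with hKdef
  have hcopy : ∀ n, IsCopy (K n) := fun n => (hφ.iterate n).isCopy
  -- The pairs of vertices whose images have distance two; they are the same for all large `n`.
  set E : ℕ → Set (V × V) := fun n => {p | ∃ c, IsVert c ∧ Commute c (K n p.1) ∧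
    Commute c (K n p.2)} with hEdef
  have hEmono : Monotone E := by
    refine monotone_nat_of_le_succ fun n p => ?_
    rintro ⟨c, hc, h1, h2⟩
    have hs : ∀ v, K (n + 1) v = φ (K n v) := fun v => Function.iterate_succ_apply' _ _ _
    refine ⟨φ c, hφ.isVert c hc, ?_, ?_⟩
    · rw [hs, hφ.commute_iff _ _ hc ((hcopy n).isVert _)]; exact h1
    · rw [hs, hφ.commute_iff _ _ hc ((hcopy n).isVert _)]; exact h2
  obtain ⟨N₀, hN₀⟩ := WellFoundedGT.monotone_chain_condition ⟨E, hEmono⟩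
  set N := N₀ + 1 with hNdef
  have hstab : E (N + N) = E N := by
    have h1 : E N₀ = E (N + N) := hN₀ (N + N) (by omega)
    have h2 : E N₀ = E N := hN₀ N (by omega)
    rw [← h1, h2]
  refine ⟨N₀, ?_⟩
  by_contra hcon
  change ¬ ∃ h, ∀ v, InTranslate h (K N v) at hcon
  have hφN := hφ.iterate N
  have hKK : ∀ v, φ^[N] (K N v) = K (N + N) v := fun v =>
    (Function.iterate_add_apply φ N N (gen Γ v)).symm
  -- A translate containing as much as possible of the copy.
  set count : PCGroup Γ → ℕ := fun h => {v | InTranslate h (K N v)}.ncard with hcount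
  have hbdd : BddAbove (Set.range count) := by
    refine ⟨Nat.card V, ?_⟩
    rintro _ ⟨h, rfl⟩
    exact Set.ncard_le_card _
  obtain ⟨h₀, hh₀⟩ := Nat.sSup_mem (Set.range_nonempty count) hbdd
  have hmax : ∀ h, count h ≤ count h₀ := fun h => by
    rw [hh₀]; exact le_csSup hbdd ⟨h, rfl⟩
  obtain ⟨h, hsub, hall | ⟨x, i, j, hi, hj, hij⟩⟩ := exists_translate (K N) (hcopy N).isVert h₀
  · exact hcon ⟨h, hall⟩
  have hle : count h₀ ≤ count h := Set.ncard_le_ncard hsub (Set.toFinite _)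
  set c := h * gen Γ x * h⁻¹ with hcdef
  have hc : IsVert c := ⟨h, x, rfl⟩
  obtain ⟨hcr, s, s', hs, hs', hss'⟩ := (hcopy N).exists_of_not_linked hΓ hc hi hj hij
  -- The part of `Γ` corresponding to this translate, enlarged by the separating vertex.
  set B₀ : Set V := {y | h * gen Γ y * h⁻¹ ∈ Set.range (K N)} with hB₀
  set B : Set V := insert x B₀ with hB
  have hcardB : count h + 1 ≤ B.ncard := by
    rw [hB, Set.ncard_insert_of_notMem (show x ∉ B₀ from hcr)]
    have hf : ∀ v, ∃ y, InTranslate h (K N v) → K N v = h * gen Γ y * h⁻¹ := by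
      intro v
      by_cases hv : InTranslate h (K N v)
      · obtain ⟨y, hy⟩ := hv
        exact ⟨y, fun _ => hy⟩
      · exact ⟨v, fun h => absurd h hv⟩
    choose f hf using hf
    have hinj : Set.InjOn f {v | InTranslate h (K N v)} := by
      intro v hv w hw e
      apply (hcopy N).injective
      rw [hf v hv, hf w hw, e]
    rw [Nat.add_le_add_iff_right, hcount]
    beta_reduce
    rw [← hinj.ncard_image]
    refine Set.ncard_le_ncard ?_ (Set.toFinite _)
    rintro _ ⟨v, hv, rfl⟩
    exact ⟨v, hf v hv⟩
  have hL : ∀ y : V, IsVert (φ^[N] (h * gen Γ y * h⁻¹)) := fun y =>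
    hφN.isVert _ ((isVert_gen y).conj h)
  obtain ⟨h₂, -, hall | ⟨w, y, z, hy, hz, hyz⟩⟩ :=
    exists_translate (fun y : B => φ^[N] (h * gen Γ y * h⁻¹)) (fun y => hL y) 1
  · -- The image of the enlarged part lies in one translate, against the maximality.
    obtain ⟨h', hh'⟩ := hφN.conj h
    have hBsub : B ⊆ {v | InTranslate (h'⁻¹ * h₂) (K N v)} := by
      intro y hy
      obtain ⟨z, hz⟩ := hall ⟨y, hy⟩
      refine ⟨z, ?_⟩
      rw [hh' _ (isVert_gen y)] at hz
      calc K N y = h'⁻¹ * (h' * φ^[N] (gen Γ y) * h'⁻¹) * h' := by simp only [hKdef]; group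
        _ = _ := by rw [hz]; group
    have h1 : B.ncard ≤ count (h'⁻¹ * h₂) := Set.ncard_le_ncard hBsub (Set.toFinite _)
    have h2 := hmax (h'⁻¹ * h₂)
    omega
  · -- A star separating the image of the enlarged part also separates the whole copy `K (N + N)`.
    set d := h₂ * gen Γ w * h₂⁻¹ with hddef
    have hd : IsVert d := ⟨h₂, w, rfl⟩
    have hφs : ∀ s, Commute c (K N s) → Commute (φ^[N] c) (K (N + N) s) := fun s hs => by
      rw [← hKK, hφN.commute_iff _ _ hc ((hcopy N).isVert s)]; exact hs
    have hnear : ∀ y : B, ¬ Commute d (φ^[N] (h * gen Γ y * h⁻¹)) →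
        ∃ v, ¬ Commute d (K (N + N) v) ∧ Linked d (φ^[N] (h * gen Γ y * h⁻¹)) (K (N + N) v) := by
      rintro ⟨y, rfl | ⟨v, hv⟩⟩ hy
      · have hns : ∃ v, Commute c (K N v) ∧ ¬ Commute d (K (N + N) v) := by
          by_contra hno
          push Not at hno
          have : d = φ^[N] c := IsVert.eq_of_commute hΓ.not_adj_of_adj_adj hΓ.eq_of_adj_adj
            ((hcopy (N + N)).isVert s) ((hcopy (N + N)).isVert s') hd (hφN.isVert c hc)
            (by rw [(hcopy (N + N)).commute_iff, ← (hcopy N).commute_iff]; exact hss')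
            (hno s hs) (hno s' hs') (hφs s hs) (hφs s' hs')
          exact hy (by rw [this])
        obtain ⟨v, hv1, hv2⟩ := hns
        exact ⟨v, hv2, .single ⟨hφN.isVert c hc, (hcopy (N + N)).isVert v, hy, hv2, hφs v hv1⟩⟩
      · simp only at hy ⊢
        rw [← hv, hKK] at hy ⊢
        exact ⟨v, hy, .refl⟩
    obtain ⟨v, hv, hyv⟩ := hnear y hy
    obtain ⟨v', hv', hzv'⟩ := hnear z hz
    obtain ⟨-, r, r', hr, hr', hrr'⟩ := (hcopy (N + N)).exists_of_not_linked hΓ hd hv hv'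
      fun hl => hyz ((hyv.trans hl).trans hzv'.symm)
    -- By stability its centre is the image of a vertex, whose star does not separate a translate.
    obtain ⟨d', hd', h1, h2⟩ : (r, r') ∈ E N := by
      rw [← hstab]; exact ⟨d, hd, hr, hr'⟩
    have hdd' : d = φ^[N] d' := IsVert.eq_of_commute hΓ.not_adj_of_adj_adj hΓ.eq_of_adj_adj
      ((hcopy (N + N)).isVert r) ((hcopy (N + N)).isVert r') hd (hφN.isVert d' hd') hrr' hr hr'
      (by rw [← hKK, hφN.commute_iff _ _ hd' ((hcopy N).isVert r)]; exact h1)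
      (by rw [← hKK, hφN.commute_iff _ _ hd' ((hcopy N).isVert r')]; exact h2)
    rw [hdd'] at hy hz hyz
    rw [hφN.commute_iff _ _ hd' ((isVert_gen _).conj h)] at hy hz
    exact hyz (hφN.linked (linked_of_translate hΓ hd' hy hz) hd')

/-- A self-map of the extension graph of an atomic graph maps `Γ` onto a translate. -/
theorem IsVertMap.exists_inTranslate [Finite V] [Nontrivial V] (hΓ : Γ.IsAtomic)
    {φ : PCGroup Γ → PCGroup Γ} (hφ : IsVertMap φ) :
    ∃ h : PCGroup Γ, ∀ v, InTranslate h (φ (gen Γ v)) := by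
  obtain ⟨N, h, hh⟩ := hφ.exists_iterate_inTranslate hΓ
  obtain ⟨g, -, hall | ⟨x, i, j, hi, hj, hij⟩⟩ :=
    exists_translate (fun v => φ (gen Γ v)) hφ.isCopy.isVert 1
  · exact ⟨g, hall⟩
  exfalso
  set c := g * gen Γ x * g⁻¹
  have hc : IsVert c := ⟨g, x, rfl⟩
  obtain ⟨hcr, s, s', hs, hs', hss'⟩ := hφ.isCopy.exists_of_not_linked hΓ hc hi hj hij
  have hφN := hφ.iterate N
  choose σ hσ using hh
  simp only [Function.iterate_succ_apply] at hσ
  have hinj : Function.Injective σ := by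
    intro v w e
    have : φ^[N] (φ (gen Γ v)) = φ^[N] (φ (gen Γ w)) := by rw [hσ, hσ, e]
    exact hφ.isCopy.injective
      (hφN.injOn _ _ (hφ.isCopy.isVert v) (hφ.isCopy.isVert w) this)
  have hvert : IsVert (h⁻¹ * φ^[N] c * h) := by simpa using (hφN.isVert c hc).conj h⁻¹
  have hcomm : ∀ s, Commute c (φ (gen Γ s)) → Commute (h⁻¹ * φ^[N] c * h) (gen Γ (σ s)) := by
    intro s hs
    rw [commute_conj_left, ← hσ, hφN.commute_iff _ _ hc (hφ.isCopy.isVert s)]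
    exact hs
  have hmem : h⁻¹ * φ^[N] c * h ∈ Set.range (gen Γ) := by
    by_contra hnr
    have := hinj (hvert.eq_of_commute_gen hΓ.eq_of_adj_adj hnr (hcomm s hs) (hcomm s' hs'))
    rw [this] at hss'
    exact hss' (Commute.refl _)
  obtain ⟨w, hw⟩ := hmem
  obtain ⟨v, rfl⟩ := Finite.surjective_of_injective hinj w
  refine hcr ⟨v, hφN.injOn _ _ (hφ.isCopy.isVert v) hc ?_⟩
  simp only [hσ, hw]
  group

/-! ### Injective endomorphisms -/

theorem not_isOfFinOrder_gen (v : V) : ¬ IsOfFinOrder (gen Γ v) := by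
  simpa using not_isOfFinOrder_gen_zpow (Γ := Γ) (y := v) one_ne_zero

/-- An injective endomorphism maps generators to conjugates of powers of generators, because
the centralizer of a generator is not abelian. -/
theorem exists_root [Finite V] [Nontrivial V] (hΓ : Γ.IsAtomic) {ψ : PCGroup Γ →* PCGroup Γ}
    (hψ : Function.Injective ψ) {a : PCGroup Γ} (ha : IsVert a) :
    ∃ c, IsVert c ∧ ∃ k : ℤ, k ≠ 0 ∧ ψ a = c ^ k := by
  obtain ⟨g, v, rfl⟩ := ha
  obtain ⟨p, hp, -⟩ := hΓ.exists_adj_ne v v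
  obtain ⟨q, hq, hqp⟩ := hΓ.exists_adj_ne v p
  have hord : ¬ IsOfFinOrder (ψ (gen Γ v)) := by
    rw [hψ.isOfFinOrder_iff]
    exact not_isOfFinOrder_gen v
  obtain ⟨u, x, j, e⟩ := exists_conj_zpow_of_commute hΓ.not_adj_of_adj_adj hΓ.eq_of_adj_adj hord
    ((gen_commute_of_adj hp).map ψ) ((gen_commute_of_adj hq).map ψ) (by
      intro k m hk hm h
      rw [← map_pow, ← map_pow] at h
      have h1 : Commute (gen Γ p ^ k) (gen Γ q ^ m) := by
        apply hψ
        rw [map_mul, map_mul]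
        exact h
      rw [← zpow_natCast, ← zpow_natCast] at h1
      have h2 := (isVert_gen p).commute_of_zpow (by omega) h1
      have h3 := (isVert_gen q).commute_of_zpow (by omega) h2.symm
      rcases commute_gen_iff.1 h3 with rfl | h4
      · exact hqp rfl
      · exact hΓ.not_adj_of_adj_adj v q p hq hp h4)
  refine ⟨ψ g * (u * gen Γ x * u⁻¹) * (ψ g)⁻¹, ((isVert_gen x).conj u).conj _, j, ?_, ?_⟩
  · rintro rfl
    rw [zpow_zero, mul_one, mul_inv_cancel] at e
    rw [e] at hord
    exact hord IsOfFinOrder.one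
  · rw [conj_zpow, conj_zpow, ← e]
    simp

/-- An injective endomorphism induces a self-map of the extension graph. -/
theorem exists_isVertMap [Finite V] [Nontrivial V] (hΓ : Γ.IsAtomic) {ψ : PCGroup Γ →* PCGroup Γ}
    (hψ : Function.Injective ψ) :
    ∃ φ : PCGroup Γ → PCGroup Γ, IsVertMap φ ∧
      ∀ a, IsVert a → ∃ k : ℤ, k ≠ 0 ∧ ψ a = φ a ^ k := by
  choose! φ hφ hφk using fun a (ha : IsVert a) => exists_root hΓ hψ ha
  refine ⟨φ, ⟨hφ, ?_, ?_, ?_⟩, hφk⟩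
  · intro a b ha hb
    obtain ⟨k, hk, e⟩ := hφk a ha
    obtain ⟨l, hl, e'⟩ := hφk b hb
    constructor
    · intro h
      apply hψ
      rw [map_mul, map_mul, e, e']
      exact h.zpow_zpow k l
    · intro h
      have h1 : Commute (φ a ^ k) (φ b ^ l) := by
        rw [← e, ← e']; exact h.map ψ
      exact ((hφ b hb).commute_of_zpow hl ((hφ a ha).commute_of_zpow hk h1).symm).symm
  · intro a b ha hb h
    obtain ⟨k, hk, e⟩ := hφk a ha
    obtain ⟨l, hl, e'⟩ := hφk b hb
    refine ha.eq_of_zpow_eq hb hl (l := k) (hψ ?_)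
    rw [map_zpow, map_zpow, e, e', h, ← zpow_mul, ← zpow_mul, mul_comm]
  · refine fun h => ⟨ψ h, fun a ha => ?_⟩
    obtain ⟨k, hk, e⟩ := hφk a ha
    obtain ⟨l, hl, e'⟩ := hφk _ (ha.conj h)
    refine (hφ _ (ha.conj h)).eq_of_zpow_eq ((hφ a ha).conj _) hl (l := k) ?_
    rw [← e', conj_zpow, ← e]
    simp

end PCGroup

open PCGroup in
theorem mainTheorem4 {V : Type*} [Finite V] (Γ : SimpleGraph V) (hΓ : Γ.IsAtomic)
    (ψ : PCGroup Γ →* PCGroup Γ) (hψ : Function.Injective ψ) :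
    ∃ (g : PCGroup Γ) (σ : Γ ≃g Γ) (k : V → ℤ),
      (∀ v : V, k v ≠ 0) ∧
      ∀ v : V, ψ (PCGroup.gen Γ v) = g⁻¹ * PCGroup.gen Γ (σ v) ^ k v * g := by
  rcases subsingleton_or_nontrivial V with hV | hV
  · -- The group is infinite cyclic.
    have hk : ∀ v : V, ∃ n : ℤ, gen Γ v ^ n = ψ (gen Γ v) := by
      intro v
      rw [← mem_par_singleton, (Set.eq_univ_of_forall fun w => Subsingleton.elim w v :
        ({v} : Set V) = Set.univ), par_univ]
      trivial
    choose k hk using hk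
    refine ⟨1, RelIso.refl _, k, fun v h => ?_, fun v => by simp [hk]⟩
    have h1 := hk v
    rw [h, zpow_zero, ← map_one ψ] at h1
    exact not_isOfFinOrder_gen v (by rw [← hψ h1]; exact IsOfFinOrder.one)
  · obtain ⟨φ, hφ, hφk⟩ := exists_isVertMap hΓ hψ
    obtain ⟨h, hh⟩ := hφ.exists_inTranslate hΓ
    choose σ hσ using hh
    choose k hk0 hk using fun v => hφk (gen Γ v) (isVert_gen v)
    have hinj : Function.Injective σ := by
      intro v w e
      apply hφ.isCopy.injective
      simp only [hσ, e]
    have hadj : ∀ v w, Γ.Adj (σ v) (σ w) ↔ Γ.Adj v w := by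
      have adj_iff : ∀ v w, Γ.Adj v w ↔ v ≠ w ∧ w ∈ Γ.closedStar v := fun v w =>
        ⟨fun h => ⟨h.ne, Or.inr h⟩, fun ⟨h1, h2⟩ => h2.resolve_left (Ne.symm h1)⟩
      intro v w
      rw [adj_iff, adj_iff, hinj.ne_iff, ← hφ.isCopy.commute_iff v w, hσ, hσ, commute_conj_gen_iff]
    refine ⟨h⁻¹, ⟨Equiv.ofBijective σ (Finite.injective_iff_bijective.1 hinj), hadj _ _⟩, k, hk0,
      fun v => ?_⟩
    rw [hk, hσ, conj_zpow, inv_inv]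
    rfl
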